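/- Let $\mathrm{Atoms}$ be an infinite set. For a finite set $S\subseteq\mathrm{Atoms}$, an $S$-permutation is a permutation of $\mathrm{Atoms}$ that fixes every element of $S$. Permutations act on objects built from atoms by renaming. Such an object is supported by $S$ if all $S$-permutations fix it, and it is finitely supported if it is supported by some finite $S$. A set is orbit-finite if its elements are finitely supported and it is a finite union of orbits under the group of $S$-permutations, for some finite $S\subseteq\mathrm{Atoms}$. Let $H$ be a finite set of labels and $\Sigma=H\times\mathrm{Atoms}$. A data vector is a function $v:\Sigma\to\mathbb N$ with $v(\sigma)=0$ for all but finitely many $\sigma$. The Parikh image $\Psi(L)$ of a language $L\subseteq\Sigma^*$ is the set of the data vectors $\sigma\mapsto(\text{number of occurrences of }\sigma\text{ in }w)$ for $w\in L$. The rational sets of data vectors form the smallest class that contains $\{\mathbf 0\}$ and every $\{\sigma\}$ with $\sigma\in\Sigma$ (identified with its indicator vector), and that is closed under Minkowski sum $X+Y$, Kleene star $X^*$ (all finite sums of elements of $X$) and orbit-finite unions $\bigcup_{x\in X}f(x)$, where $X$ is orbit-finite and the map $f$ on $X$ is finitely supported. The star-height of a rational set is the smallest nesting depth of the Kleene star in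 a rational expression that defines it. A one-register finite-memory automaton has a finite set of states with an initial state and a set of accepting states, a finite label set $H$, a finite set $D$ of distinguished atoms, an initial register value in $\mathrm{Atoms}$, and finitely many rules $s\xrightarrow{h,\varphi}s'$, where $s,s'$ are states, $h\in H$, and $\varphi$ is a Boolean combination of equalities between $x$, $y$, $x'$ and constants from $D$. Such a rule lets the automaton read the letter $(h,b)$ and pass from state $s$ with register value $a$ to state $s'$ with register value $a'$ whenever $(x,y,x')=(a,b,a')$ satisfies $\varphi$. The recognised language consists of all words over $\Sigma$ that have a run from the initial state and initial register value to some accepting state with any register value. **Theorem.** The Parikh image of the language recognised by any one-register finite-memory automaton is a rational set of data vectors of star-height at most two. The bound is tight: there is a one-register finite-memory automaton whose language has a Parikh image of star-height exactly two. -/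

import Mathlib

open scoped Pointwise

universe u v w

/-! ## Orbit-finite sets

`Equiv.Perm Atoms` acts on `Atoms` and on other types.  For a set `S` of atoms the group of
`S`-permutations is `fixingSubgroup (Equiv.Perm Atoms) S`, and `MulAction.Supports` is
Mathlib's notion of a support. -/

/-- A set `X` is orbit-finite if its elements have finite supports and it is a finite union of
`S`-orbits, for some finite set `S` of atoms. -/
def IsOrbitFinite (Atoms : Type u) {ι : Type w} [MulAction (Equiv.Perm Atoms) ι]
    (X : Set ι) : Prop :=
  (∀ x ∈ X, ∃ S : Set Atoms, S.Finite ∧ MulAction.Supports (Equiv.Perm Atoms) S x) ∧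
  ∃ S : Set Atoms, S.Finite ∧ ∃ T : Set ι, T.Finite ∧
    X = ⋃ t ∈ T, MulAction.orbit (fixingSubgroup (Equiv.Perm Atoms) S) t

/-! ## Data vectors -/

/-- Data vectors over the alphabet `H × Atoms`: functions to `ℕ` that vanish at all but finitely
many letters. -/
abbrev DataVector (H : Type v) (Atoms : Type u) : Type (max u v) := (H × Atoms) →₀ ℕ

namespace DataVector

variable {H : Type v} {Atoms : Type u}

/-- The action of a permutation of the atoms on a data vector, by renaming letters
(labels are not changed). -/
noncomputable def rename (π : Equiv.Perm Atoms) (x : DataVector H Atoms) : DataVector H Atoms :=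
  Finsupp.mapDomain (Prod.map id π) x

/-- The Parikh vector of a word: the number of occurrences of each letter. -/
noncomputable def parikh (word : List (H × Atoms)) : DataVector H Atoms :=
  (word.map fun σ => Finsupp.single σ 1).sum

theorem parikh_apply [DecidableEq (H × Atoms)] (word : List (H × Atoms)) (σ : H × Atoms) :
    parikh word σ = word.count σ := by
  induction word with
  | nil => simp [parikh]
  | cons a l ih =>
    simp only [parikh, List.map_cons, List.sum_cons, Finsupp.add_apply] at ih ⊢
    rw [ih, List.count_cons, Finsupp.single_apply, add_comm]
    simp

/-- The Parikh image of a language. -/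
def parikhImage (L : Language (H × Atoms)) : Set (DataVector H Atoms) :=
  {x | ∃ word ∈ L, parikh word = x}

/-- The Kleene star of a set of data vectors: all finite sums of its elements. -/
def kleeneStar (R : Set (DataVector H Atoms)) : Set (DataVector H Atoms) :=
  {x | ∃ l : List (DataVector H Atoms), (∀ y ∈ l, y ∈ R) ∧ l.sum = x}

/-- A map `f` from a set `X` to sets of data vectors is finitely supported: for some finite set
`S` of atoms, the graph of `f` on `X` is invariant under all `S`-permutations. -/
def FinitelySupportedOn {ι : Type w} [MulAction (Equiv.Perm Atoms) ι]
    (X : Set ι) (f : ι → Set (DataVector H Atoms)) : Prop :=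
  ∃ S : Set Atoms, S.Finite ∧ ∀ π ∈ fixingSubgroup (Equiv.Perm Atoms) S, ∀ x ∈ X,
    π • x ∈ X ∧ f (π • x) = rename π '' f x

/-- `HasRationalExpr n R`: the set `R` is defined by a rational expression in which Kleene stars
are nested at most `n` deep.  Rational expressions are built from the zero vector and single
letters by Minkowski sums, Kleene stars and orbit-finite unions. -/
inductive HasRationalExpr : ℕ → Set (DataVector H Atoms) → Prop
  | zero (n : ℕ) : HasRationalExpr n {0}
  | letter (n : ℕ) (σ : H × Atoms) : HasRationalExpr n {Finsupp.single σ 1}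
  | add {n : ℕ} {R R' : Set (DataVector H Atoms)} :
      HasRationalExpr n R → HasRationalExpr n R' → HasRationalExpr n (R + R')
  | kleeneStar {n : ℕ} {R : Set (DataVector H Atoms)} :
      HasRationalExpr n R → HasRationalExpr (n + 1) (kleeneStar R)
  | orbitFiniteUnion {n : ℕ} {ι : Type u} [MulAction (Equiv.Perm Atoms) ι]
      (X : Set ι) (f : ι → Set (DataVector H Atoms)) :
      IsOrbitFinite Atoms X → FinitelySupportedOn X f →
      (∀ x ∈ X, HasRationalExpr n (f x)) → HasRationalExpr n (⋃ x ∈ X, f x)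

/-- Rational sets of data vectors: the smallest class of sets that contains the zero vector and
the single letters and is closed under sums, Kleene stars and orbit-finite unions. -/
inductive IsRational : Set (DataVector H Atoms) → Prop
  | zero : IsRational {0}
  | letter (σ : H × Atoms) : IsRational {Finsupp.single σ 1}
  | add {R R' : Set (DataVector H Atoms)} :
      IsRational R → IsRational R' → IsRational (R + R')
  | kleeneStar {R : Set (DataVector H Atoms)} : IsRational R → IsRational (kleeneStar R)
  | orbitFiniteUnion {ι : Type u} [MulAction (Equiv.Perm Atoms) ι]
      (X : Set ι) (f : ι → Set (DataVector H Atoms)) :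
      IsOrbitFinite Atoms X → FinitelySupportedOn X f →
      (∀ x ∈ X, IsRational (f x)) → IsRational (⋃ x ∈ X, f x)

/-- The star-height of a set of data vectors: the smallest star-nesting depth of a rational
expression that defines it (and `⊤` if there is none). -/
noncomputable def starHeight (R : Set (DataVector H Atoms)) : ℕ∞ :=
  ⨅ (n : ℕ) (_ : HasRationalExpr n R), (n : ℕ∞)

end DataVector

/-! ## Finite-memory automata -/

namespace FMA

/-- The terms of a transition constraint with `r` registers and distinguished atoms `D`: current
register values, the input atom, next register values, and constants. -/
inductive Term (r : ℕ) {Atoms : Type u} (D : Finset Atoms) : Type u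
  | reg (i : Fin r)
  | input
  | next (i : Fin r)
  | const (d : D)

/-- Transition constraints: Boolean combinations of equalities between terms. -/
inductive Constraint (r : ℕ) {Atoms : Type u} (D : Finset Atoms) : Type u
  | top
  | eq (s t : Term r D)
  | not (φ : Constraint r D)
  | and (φ ψ : Constraint r D)
  | or (φ ψ : Constraint r D)

variable {r : ℕ} {Atoms : Type u} {D : Finset Atoms}

/-- The atom denoted by a term, given the current register values `a`, the input atom `b` and the
next register values `a'`. -/
def Term.val (a : Fin r ↪ Atoms) (b : Atoms) (a' : Fin r ↪ Atoms) : Term r D → Atoms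
  | .reg i => a i
  | .input => b
  | .next i => a' i
  | .const d => d

/-- Satisfaction of a transition constraint. -/
def Constraint.Holds (a : Fin r ↪ Atoms) (b : Atoms) (a' : Fin r ↪ Atoms) :
    Constraint r D → Prop
  | .top => True
  | .eq s t => s.val a b a' = t.val a b a'
  | .not φ => ¬ φ.Holds a b a'
  | .and φ ψ => φ.Holds a b a' ∧ ψ.Holds a b a'
  | .or φ ψ => φ.Holds a b a' ∨ ψ.Holds a b a'

end FMA

/-- An `r`-register finite-memory automaton with labels `H` and states `State` (both types are
assumed finite where automata are used).  Register assignments are `r`-tuples of pairwise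
distinct atoms, i.e. injections `Fin r ↪ Atoms`. -/
structure FMA (r : ℕ) (Atoms : Type u) (H : Type v) (State : Type w) where
  /-- the initial state -/
  init : State
  /-- the accepting states -/
  accept : Set State
  /-- the distinguished atoms -/
  D : Finset Atoms
  /-- the initial register assignment -/
  initReg : Fin r ↪ Atoms
  /-- the transition rules: source state, label, constraint, target state -/
  rules : Set (State × H × FMA.Constraint r D × State)
  rules_finite : rules.Finite

namespace FMA

variable {r : ℕ} {Atoms : Type u} {H : Type v} {State : Type w}

/-- One transition between configurations, reading one letter. -/
def Step (A : FMA r Atoms H State) (c : State × (Fin r ↪ Atoms)) (σ : H × Atoms)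
    (c' : State × (Fin r ↪ Atoms)) : Prop :=
  ∃ φ : Constraint r A.D, (c.1, σ.1, φ, c'.1) ∈ A.rules ∧ φ.Holds c.2 σ.2 c'.2

/-- `A.Run c word c'`: there is a run on `word` from the configuration `c` to `c'`. -/
inductive Run (A : FMA r Atoms H State) :
    State × (Fin r ↪ Atoms) → List (H × Atoms) → State × (Fin r ↪ Atoms) → Prop
  | nil (c : State × (Fin r ↪ Atoms)) : A.Run c [] c
  | cons {c c' c'' : State × (Fin r ↪ Atoms)} {σ : H × Atoms} {word : List (H × Atoms)} :
      A.Step c σ c' → A.Run c' word c'' → A.Run c (σ :: word) c''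

/-- The language recognised by an automaton: the words with a run from the initial configuration
to an accepting configuration. -/
def language (A : FMA r Atoms H State) : Language (H × Atoms) :=
  {word | ∃ c : State × (Fin r ↪ Atoms), A.Run (A.init, A.initReg) word c ∧ c.1 ∈ A.accept}

end FMA

/-!
The upper bound on the star-height rests on one combinatorial theorem, applied twice.

A *link system* describes words locally: a letter leads from one control state to another (finitely
many in all), carries an atom, and forbids the next letter to carry one of at most two atoms.  Let
the letters stand for sets of data vectors.  Up to the order of its letters, every linked word
consists of a linked word `b` of bounded length and cycles of bounded length which `b` absorbs
(`LinkSystem.exists_decomposition`): among any six letters with the same source, two can be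
exchanged as continuations, which cuts out a cycle, and a bounded number of adjacent pairs of
letters can be retained so that `b` has all the room that is needed later.  Conversely, `b` together
with any multiset of cycles that it absorbs can be arranged to a linked word
(`LinkSystem.Linked.exists_absorb`): a cycle whose first atom occurs in `b` at the right control
state is inserted at that place; all other cycles can first be merged into a number of loops that
depends only on the control states, and each of these finds a place of its own, since `b` has many
places with distinct atoms.  So the sums over all linked words are the union over the bounded words
`b` of `b + (⋃ z)*`, where `z` ranges over the bounded cycles that `b` absorbs.  Both unions are
orbit-finite, whence one more star is enough (`DataVector.HasRationalExpr.linkedWords`).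

The first application is to the blocks of an automaton, the runs on which the register keeps its
value; nothing is forbidden there, and the result is Parikh's theorem with one star
(`FMA.hasRationalExpr_block`).  For the second, a run is cut where the register value changes, and
the letters are the blocks.  The new value must differ from the old one and possibly from the atom
just read; values in the finite set `S`, which holds the distinguished atoms and the initial value,
are kept in the control state.  If the atom read is the new value itself, the coming block reads it.
This gives two nested stars (`FMA.hasRationalExpr_parikhImage`).

For the lower bound, each element of a set of star-height at most one lies in a subset of the form
`b + P*` with `b` and the elements of `P` uniformly bounded
(`DataVector.HasRationalExpr.exists_isBoundedlyLinear`).  This fails for the words made of blocks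
`(false, a) (true, a) ⋯ (true, a)`: with enough atoms some `a` is missing from `b`, and with enough
letters `(true, a)` some period contains one of them but not the only `(false, a)`; added to `b`, it
leaves the set (`DataVector.not_isBoundedlyLinear`).
-/

/-! ### Linked words -/

/-- A local description of a set of words over `Λ`.  A letter `l` leads from the control state
`src l` to the control state `tgt l`; it carries an atom `inn l`, and it forbids the next letter to
carry one of the at most two atoms in `out l`. -/
structure LinkSystem (Λ : Type*) (T : Type*) (A : Type*) where
  /-- the control state before a letter -/
  src : Λ → T
  /-- the control state after a letter -/
  tgt : Λ → T
  /-- the atom carried by a letter -/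
  inn : Λ → A
  /-- the atoms that the next letter must not carry -/
  out : Λ → Finset A
  card_out_le : ∀ l, (out l).card ≤ 2

namespace LinkSystem

variable {Λ T A : Type*}

/-- The letter `y` occurs immediately after the letter `x` in the word. -/
def Adj (word : List Λ) (x y : Λ) : Prop := ∃ s t, word = s ++ x :: y :: t

theorem adj_cons {a : Λ} {l : List Λ} {x y : Λ} :
    Adj (a :: l) x y ↔ (a = x ∧ l.head? = some y) ∨ Adj l x y := by
  constructor
  · rintro ⟨s, t, h⟩
    cases s with
    | nil => simp only [List.nil_append, List.cons.injEq] at h; left; simp [h.1, h.2]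
    | cons b s =>
      simp only [List.cons_append, List.cons.injEq] at h
      exact Or.inr ⟨s, t, h.2⟩
  · rintro (⟨rfl, h⟩ | ⟨s, t, rfl⟩)
    · cases l with
      | nil => simp at h
      | cons b l => simp only [List.head?_cons, Option.some.injEq] at h; exact ⟨[], l, by simp [h]⟩
    · exact ⟨a :: s, t, by simp⟩

theorem not_adj_nil {x y : Λ} : ¬ Adj [] x y := by
  rintro ⟨s, t, h⟩
  simp at h

theorem adj_append {l l' : List Λ} {x y : Λ} :
    Adj (l ++ l') x y ↔ Adj l x y ∨ Adj l' x y ∨ (l.getLast? = some x ∧ l'.head? = some y) := by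
  induction l with
  | nil => simp [not_adj_nil]
  | cons a l ih =>
    rw [List.cons_append, adj_cons, adj_cons, ih]
    cases l with
    | nil => simp [not_adj_nil]; tauto
    | cons b l => simp [List.getLast?_cons_cons]; tauto

theorem Adj.mem_tail {word : List Λ} {x y : Λ} (h : Adj word x y) : y ∈ word.tail := by
  obtain ⟨s, t, rfl⟩ := h
  cases s <;> simp

theorem exists_adj_of_mem_tail {word : List Λ} {y : Λ} (h : y ∈ word.tail) :
    ∃ x, Adj word x y := by
  cases word with
  | nil => simp at h
  | cons a l =>
    simp only [List.tail_cons] at h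
    obtain ⟨s, t, rfl⟩ := List.append_of_mem h
    rcases List.eq_nil_or_concat s with rfl | ⟨s, b, rfl⟩
    · exact ⟨a, [], t, by simp⟩
    · exact ⟨b, a :: s, t, by simp⟩

variable (G : LinkSystem Λ T A)

/-- The letter `l'` may follow the letter `l`. -/
def Link (l l' : Λ) : Prop := G.tgt l = G.src l' ∧ G.inn l' ∉ G.out l

/-- A word is linked if each letter may follow the preceding one. -/
def Linked (word : List Λ) : Prop := word.IsChain G.Link

/-- A cycle is a nonempty word that may be repeated. -/
structure IsCycle (z : List Λ) : Prop where
  ne_nil : z ≠ []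
  linked : G.Linked (z ++ z)

variable {G}

theorem linked_append {l l' : List Λ} : G.Linked (l ++ l') ↔
    G.Linked l ∧ G.Linked l' ∧ ∀ x ∈ l.getLast?, ∀ y ∈ l'.head?, G.Link x y :=
  List.isChain_append

theorem Linked.link_of_adj {word : List Λ} (h : G.Linked word) {x y : Λ} (ha : Adj word x y) :
    G.Link x y := by
  obtain ⟨s, t, rfl⟩ := ha
  exact (List.isChain_append_cons_cons.1 h).2.1

/-! ### Decomposing a linked word into a short linked word and short cycles -/

/-- Among six steps `(X k, a k)`, two can exchange their second components: each `X k` contains at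
most two of the atoms, while every pair that cannot be exchanged needs one such containment. -/
theorem exists_exchangeable (X : Fin 6 → Finset A) (a : Fin 6 → A) (hX : ∀ k, (X k).card ≤ 2)
    (ha : ∀ k, a k ∉ X k) : ∃ k l, k < l ∧ a l ∉ X k ∧ a k ∉ X l := by
  classical
  by_contra! hcon
  have hinj : Function.Injective a := by
    intro k l hkl
    by_contra hne
    rcases lt_or_gt_of_ne hne with h | h
    · exact ha l (hkl ▸ hcon k l h (hkl ▸ ha k))
    · exact ha k (hkl ▸ hcon l k h (hkl ▸ ha l))
  set E : Finset (Fin 6 × Fin 6) := Finset.univ.filter fun p => a p.2 ∈ X p.1 with hE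
  have hEcard : E.card ≤ 12 := by
    have h1 : E.card = ∑ k, (E.filter fun p => p.1 = k).card :=
      Finset.card_eq_sum_card_fiberwise (fun _ _ => Finset.mem_coe.2 (Finset.mem_univ _))
    have h2 : ∀ k, (E.filter fun p => p.1 = k).card ≤ 2 := by
      intro k
      refine le_trans ?_ (hX k)
      refine Finset.card_le_card_of_injOn (fun p => a p.2) ?_ ?_
      · intro p hp
        simp only [hE, Finset.coe_filter, Finset.mem_filter, Finset.mem_univ, true_and,
          Set.mem_ofPred_eq] at hp
        rw [← hp.2]; exact hp.1
      · intro p hp q hq h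
        simp only [Finset.coe_filter, Set.mem_ofPred_eq] at hp hq
        exact Prod.ext (hp.2.trans hq.2.symm) (hinj h)
    rw [h1]
    exact (Finset.sum_le_sum fun k _ => h2 k).trans (by simp)
  have hsub : (Finset.univ : Finset (Fin 6)).offDiag ⊆ E ∪ E.image Prod.swap := by
    rintro ⟨k, l⟩ h
    simp only [Finset.mem_offDiag, Finset.mem_univ, true_and] at h
    have key : ∀ k l : Fin 6, k < l → a l ∈ X k ∨ a k ∈ X l := fun k l hkl => by
      by_cases h : a l ∈ X k
      · exact Or.inl h
      · exact Or.inr (hcon k l hkl h)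
    have : a l ∈ X k ∨ a k ∈ X l := by
      rcases lt_or_gt_of_ne h with h | h
      · exact key k l h
      · exact (key l k h).symm
    simpa [hE] using this
  have h3 := (Finset.card_le_card hsub).trans (Finset.card_union_le _ _)
  have h4 : (E.image Prod.swap).card ≤ E.card := Finset.card_image_le
  have h5 : (Finset.univ : Finset (Fin 6)).offDiag.card = 30 := by
    rw [Finset.offDiag_card]; simp
  omega

/-- A long linked word contains a short cycle that can be cut out. -/
theorem Linked.exists_cut [Fintype T] {s : List Λ} (hs : G.Linked s)
    (hlen : 5 * Fintype.card T + 1 < s.length) :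
    ∃ s₁ z s₂, s = s₁ ++ z ++ s₂ ∧ s₁ ≠ [] ∧ s₂ ≠ [] ∧ z.length ≤ 5 * Fintype.card T + 1 ∧
      G.IsCycle z ∧ G.Linked (s₁ ++ s₂) := by
  classical
  set N := 5 * Fintype.card T + 1 with hN
  obtain ⟨t, -, ht⟩ := Finset.exists_lt_card_fiber_of_mul_lt_card_of_maps_to
    (s := (Finset.univ : Finset (Fin N))) (t := (Finset.univ : Finset T))
    (f := fun i => G.src (s[(i : ℕ) + 1]'(by omega))) (n := 5)
    (fun _ _ => Finset.mem_univ _) (by simp [hN]; omega)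
  obtain ⟨I, hI, hIcard⟩ := Finset.exists_subset_card_eq (Nat.succ_le_of_lt ht)
  let e := I.orderEmbOfFin hIcard
  have he : ∀ k, G.src (s[(e k : ℕ) + 1]'(by omega)) = t := fun k => by
    have := hI (I.orderEmbOfFin_mem hIcard k)
    simpa using this
  have hlink : ∀ i (h : i + 1 < s.length), G.Link s[i] s[i + 1] :=
    fun i h => List.isChain_iff_getElem.1 hs i h
  obtain ⟨k, l, hkl, h1, h2⟩ := exists_exchangeable
    (fun k => G.out (s[(e k : ℕ)]'(by omega)))
    (fun k => G.inn (s[(e k : ℕ) + 1]'(by omega))) (fun _ => G.card_out_le _)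
    (fun k => (hlink _ _).2)
  obtain ⟨i, j, hij, hjN, li, lj, hst, h1, h2⟩ : ∃ (i j : ℕ) (hij : i < j) (hjN : j < N),
      G.Link (s[i]'(by omega)) (s[i + 1]'(by omega)) ∧
      G.Link (s[j]'(by omega)) (s[j + 1]'(by omega)) ∧
      G.src (s[i + 1]'(by omega)) = G.src (s[j + 1]'(by omega)) ∧
      G.inn (s[j + 1]'(by omega)) ∉ G.out (s[i]'(by omega)) ∧
      G.inn (s[i + 1]'(by omega)) ∉ G.out (s[j]'(by omega)) :=
    ⟨e k, e l, e.strictMono hkl, (e l).2, hlink _ _, hlink _ _, (he k).trans (he l).symm, h1, h2⟩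
  have hsplit : s = s.take (i + 1) ++ (s.drop (i + 1)).take (j - i) ++ s.drop (j + 1) := by
    have h3 : s.drop (j + 1) = (s.drop (i + 1)).drop (j - i) := by
      rw [List.drop_drop]; congr 1; omega
    rw [List.append_assoc, h3, List.take_append_drop, List.take_append_drop]
  have hs' := hs
  rw [hsplit, linked_append, linked_append] at hs'
  obtain ⟨⟨v1, v2, -⟩, v3, -⟩ := hs'
  have hz : ((s.drop (i + 1)).take (j - i)).length = j - i := by
    simp; omega
  refine ⟨_, _, _, hsplit, ?_, ?_, hz.le.trans (by omega), ⟨?_, ?_⟩, ?_⟩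
  · intro h; have := congrArg List.length h; rw [List.length_take, List.length_nil] at this; omega
  · intro h; have := congrArg List.length h; rw [List.length_drop, List.length_nil] at this; omega
  · intro h; have := congrArg List.length h; rw [hz, List.length_nil] at this; omega
  · refine linked_append.2 ⟨v2, v2, ?_⟩
    intro x hx y hy
    have hx' : x = s[j] := by
      rw [List.getLast?_eq_getElem?, hz] at hx
      simp only [List.getElem?_take, List.getElem?_drop, Option.mem_def] at hx
      rw [if_pos (by omega), show i + 1 + (j - i - 1) = j by omega,
        List.getElem?_eq_getElem (by omega)] at hx
      simpa using hx.symm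
    have hy' : y = s[i + 1] := by
      rw [List.head?_take, if_neg (by omega), List.head?_drop,
        List.getElem?_eq_getElem (by omega)] at hy
      simpa using hy.symm
    subst hx' hy'
    exact ⟨lj.1.trans hst.symm, h2⟩
  · refine linked_append.2 ⟨v1, v3, ?_⟩
    intro x hx y hy
    have hx' : x = s[i] := by
      rw [List.getLast?_eq_getElem?] at hx
      simp only [List.length_take, List.getElem?_take, Option.mem_def] at hx
      rw [min_eq_left (by omega), if_pos (by omega), Nat.add_sub_cancel,
        List.getElem?_eq_getElem (by omega)] at hx
      simpa using hx.symm
    have hy' : y = s[j + 1] := by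
      rw [List.head?_drop, List.getElem?_eq_getElem (by omega)] at hy
      simpa using hy.symm
    subst hx' hy'
    exact ⟨li.1.trans hst, h1⟩

/-- Repeatedly cutting out short cycles leaves a short word.  The cycles start with letters of
the original word. -/
theorem Linked.exists_reduced [Fintype T] {s : List Λ} (hs : G.Linked s) :
    ∃ (b : List Λ) (zs : List (List Λ)), G.Linked b ∧ b.head? = s.head? ∧
      b.getLast? = s.getLast? ∧ b.length ≤ 5 * Fintype.card T + 1 ∧ s.Perm (b ++ zs.flatten) ∧
      ∀ z ∈ zs, G.IsCycle z ∧ z.length ≤ 5 * Fintype.card T + 1 ∧ ∀ h ∈ z.head?, h ∈ s.tail := by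
  induction hn : s.length using Nat.strong_induction_on generalizing s with
  | _ n ih =>
    by_cases hlen : s.length ≤ 5 * Fintype.card T + 1
    · exact ⟨s, [], hs, rfl, rfl, hlen, by simp, by simp⟩
    obtain ⟨s₁, z, s₂, rfl, h1, h2, hz, hcyc, hs'⟩ := hs.exists_cut (not_le.1 hlen)
    have hzne := hcyc.ne_nil
    have hzlen := List.length_pos_iff.2 hzne
    obtain ⟨b, zs, hb, hh, hl, hbl, hp, hzs⟩ := ih (s₁ ++ s₂).length
      (by simp at hn ⊢; omega) hs' rfl
    obtain ⟨a, s₁, rfl⟩ := List.exists_cons_of_ne_nil h1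
    refine ⟨b, z :: zs, hb, by simp [hh], ?_, hbl, ?_, ?_⟩
    · rw [hl, List.getLast?_append_of_ne_nil _ h2, List.getLast?_append_of_ne_nil _ h2]
    · rw [List.flatten_cons]
      calc (a :: s₁ ++ z ++ s₂).Perm (z ++ (a :: s₁ ++ s₂)) := by
            rw [← List.append_assoc]; exact (List.perm_append_comm).append_right _
        _ |>.Perm (z ++ (b ++ zs.flatten)) := hp.append_left _
        _ |>.Perm (b ++ (z ++ zs.flatten)) := by
            rw [← List.append_assoc, ← List.append_assoc]
            exact (List.perm_append_comm).append_right _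
    · intro y hy
      rcases List.mem_cons.1 hy with rfl | hy
      · refine ⟨hcyc, hz, fun h hh => ?_⟩
        have := List.mem_of_mem_head? hh
        simp [this]
      · obtain ⟨c1, c2, c3⟩ := hzs y hy
        refine ⟨c1, c2, fun h hh => ?_⟩
        have := c3 h hh
        simp only [List.cons_append, List.tail_cons, List.mem_append] at this ⊢
        tauto

/-- The reduction can retain any given set of adjacent pairs. -/
theorem Linked.exists_reduced_retaining [Fintype T] [DecidableEq Λ] {s : List Λ}
    (hs : G.Linked s)
    (P : Finset (Λ × Λ)) (hP : ∀ p ∈ P, Adj s p.1 p.2) :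
    ∃ (b : List Λ) (zs : List (List Λ)), G.Linked b ∧ b.head? = s.head? ∧
      b.getLast? = s.getLast? ∧ b.length ≤ (P.card + 1) * (5 * Fintype.card T + 1) ∧
      s.Perm (b ++ zs.flatten) ∧ (∀ p ∈ P, Adj b p.1 p.2) ∧
      ∀ z ∈ zs, G.IsCycle z ∧ z.length ≤ 5 * Fintype.card T + 1 ∧ ∀ h ∈ z.head?, h ∈ s.tail := by
  classical
  induction hn : P.card using Nat.strong_induction_on generalizing s P with
  | _ n ih =>
    rcases P.eq_empty_or_nonempty with rfl | ⟨p, hp⟩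
    · obtain ⟨b, zs, h1, h2, h3, h4, h5, h6⟩ := hs.exists_reduced
      refine ⟨b, zs, h1, h2, h3, ?_, h5, by simp, h6⟩
      have : n = 0 := by simpa using hn.symm
      simpa [this] using h4
    obtain ⟨l, l', hll⟩ := hP p hp
    have hs12 : s = (l ++ [p.1]) ++ (p.2 :: l') := by simp [hll]
    set s₁ := l ++ [p.1] with hs1
    set s₂ := p.2 :: l' with hs2
    have hlast : s₁.getLast? = some p.1 := by simp [hs1]
    have hhead : s₂.head? = some p.2 := by simp [hs2]
    subst hs12
    obtain ⟨v1, v2, v3⟩ := linked_append.1 hs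
    set P₁ := (P.erase p).filter fun q => Adj s₁ q.1 q.2 with hP1
    set P₂ := (P.erase p).filter fun q => ¬ Adj s₁ q.1 q.2 with hP2
    have hcard : P₁.card + P₂.card + 1 = n := by
      rw [Finset.card_filter_add_card_filter_not, ← hn, Finset.card_erase_add_one hp]
    obtain ⟨b₁, zs₁, a1, a2, a3, a4, a5, a6, a7⟩ := ih P₁.card (by omega) v1 P₁
      (fun q hq => (Finset.mem_filter.1 hq).2) rfl
    obtain ⟨b₂, zs₂, c1, c2, c3, c4, c5, c6, c7⟩ := ih P₂.card (by omega) v2 P₂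
      (fun q hq => by
        obtain ⟨hq1, hq2⟩ := Finset.mem_filter.1 hq
        obtain ⟨hne, hqP⟩ := Finset.mem_erase.1 hq1
        rcases adj_append.1 (hP q hqP) with h | h | ⟨h, h'⟩
        · exact absurd h hq2
        · exact h
        · rw [hlast] at h; rw [hhead] at h'
          exact absurd (Prod.ext (Option.some.inj h).symm (Option.some.inj h').symm) hne) rfl
    refine ⟨b₁ ++ b₂, zs₁ ++ zs₂, linked_append.2 ⟨a1, c1, ?_⟩, ?_, ?_, ?_, ?_, ?_, ?_⟩
    · rw [a3, c2]; exact v3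
    · rw [List.head?_append, List.head?_append, a2]
      simp [c2]
    · rw [List.getLast?_append, List.getLast?_append, c3, a3]
    · rw [List.length_append, ← hcard]
      calc _ ≤ (P₁.card + 1) * (5 * Fintype.card T + 1) +
            (P₂.card + 1) * (5 * Fintype.card T + 1) := add_le_add a4 c4
        _ = _ := by ring
    · rw [List.flatten_append]
      refine (a5.append c5).trans ?_
      simp only [List.append_assoc]
      refine List.Perm.append_left _ ?_
      simp only [← List.append_assoc]
      exact List.perm_append_comm.append_right _
    · intro q hq
      rw [adj_append]
      by_cases hqp : q = p
      · subst hqp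
        exact Or.inr (Or.inr ⟨a3.trans hlast, c2.trans hhead⟩)
      by_cases hq1 : Adj s₁ q.1 q.2
      · exact Or.inl (a6 q (Finset.mem_filter.2 ⟨Finset.mem_erase.2 ⟨hqp, hq⟩, hq1⟩))
      · exact Or.inr (Or.inl (c6 q (Finset.mem_filter.2 ⟨Finset.mem_erase.2 ⟨hqp, hq⟩, hq1⟩)))
    · have hne : s₁ ≠ [] := by simp [hs1]
      have hsub : ∀ h, h ∈ s₁.tail ∨ h ∈ s₂.tail → h ∈ (s₁ ++ s₂).tail := by
        intro h hh
        rw [List.tail_append_of_ne_nil hne, List.mem_append]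
        exact hh.imp id List.mem_of_mem_tail
      intro z hz
      rcases List.mem_append.1 hz with hz | hz
      · obtain ⟨d1, d2, d3⟩ := a7 z hz
        exact ⟨d1, d2, fun h hh => hsub h (Or.inl (d3 h hh))⟩
      · obtain ⟨d1, d2, d3⟩ := c7 z hz
        exact ⟨d1, d2, fun h hh => hsub h (Or.inr (d3 h hh))⟩

variable (G) in
/-- At least `m` distinct atoms are carried by letters with source `t` that occur in the word
after a letter which does not forbid the atom `a`. -/
def Roomy (m : ℕ) (word : List Λ) (t : T) (a : A) : Prop :=
  ∃ F : Finset A, m ≤ F.card ∧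
    ∀ c ∈ F, ∃ x y, Adj word x y ∧ G.src y = t ∧ a ∉ G.out x ∧ G.inn y = c

variable (G) in
/-- A sufficient condition for the word `b` to absorb cycles that start with the letter `h`:
either a letter of `b`, not the first, agrees with `h` in its source and its atom, or there are
`m` places at which `h` may follow a letter of `b`, with distinct atoms on the letters after it. -/
def Absorbs (m : ℕ) (b : List Λ) (h : Λ) : Prop :=
  (∃ l ∈ b.tail, G.src l = G.src h ∧ G.inn l = G.inn h) ∨ G.Roomy m b (G.src h) (G.inn h)

/-- A bounded number of adjacent pairs of a word ensures that all its letters are absorbed.  For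
each control state, up to `m` carried atoms are represented; an atom that is forbidden at one of
the representing places gets a representative of its own. -/
theorem exists_absorbing_pairs [Fintype T] (m : ℕ) (s : List Λ) :
    ∃ P : Finset (Λ × Λ), P.card ≤ Fintype.card T * (3 * m) ∧ (∀ p ∈ P, Adj s p.1 p.2) ∧
      ∀ b : List Λ, (∀ p ∈ P, Adj b p.1 p.2) → ∀ h ∈ s.tail, G.Absorbs m b h := by
  classical
  let At : T → Finset A := fun t => (s.tail.filter fun l => G.src l = t).toFinset.image G.inn
  have hAt : ∀ t a, a ∈ At t ↔ ∃ l ∈ s.tail, G.src l = t ∧ G.inn l = a := by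
    intro t a
    simp [At, and_assoc]
  have hρ : ∀ t a, ∃ p : Option (Λ × Λ), a ∈ At t → ∃ q, p = some q ∧ Adj s q.1 q.2 ∧
      G.src q.2 = t ∧ G.inn q.2 = a := by
    intro t a
    by_cases h : a ∈ At t
    · obtain ⟨l, hl, h1, h2⟩ := (hAt t a).1 h
      obtain ⟨x, hx⟩ := exists_adj_of_mem_tail hl
      exact ⟨some (x, l), fun _ => ⟨(x, l), rfl, hx, h1, h2⟩⟩
    · exact ⟨none, fun h' => absurd h' h⟩
  choose ρ hρ using hρ
  have hA1 : ∀ t, ∃ A₁ ⊆ At t, A₁.card ≤ m ∧ (A₁.card = m ∨ A₁ = At t) := by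
    intro t
    by_cases h : m ≤ (At t).card
    · obtain ⟨A₁, h1, h2⟩ := Finset.exists_subset_card_eq h
      exact ⟨A₁, h1, h2.le, Or.inl h2⟩
    · exact ⟨At t, subset_rfl, (not_le.1 h).le, Or.inr rfl⟩
  choose A₁ hsub hle hor using hA1
  let U : T → Finset A := fun t => (A₁ t).biUnion fun a => (ρ t a).elim ∅ fun q => G.out q.1
  have hU : ∀ t, (U t).card ≤ m * 2 := by
    intro t
    refine (Finset.card_biUnion_le_card_mul _ _ 2 fun a _ => ?_).trans
      (Nat.mul_le_mul_right _ (hle t))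
    cases ρ t a with
    | none => simp
    | some q => exact G.card_out_le _
  let B : T → Finset A := fun t => A₁ t ∪ (At t ∩ U t)
  have hB : ∀ t, (B t).card ≤ 3 * m := by
    intro t
    have h1 := Finset.card_union_le (A₁ t) (At t ∩ U t)
    have h2 := Finset.card_le_card (Finset.inter_subset_right (s₁ := At t) (s₂ := U t))
    have h3 := hle t
    have h4 := hU t
    simp only [B]
    omega
  have hBsub : ∀ t, B t ⊆ At t := fun t =>
    Finset.union_subset (hsub t) Finset.inter_subset_left
  let P : Finset (Λ × Λ) := Finset.univ.biUnion fun t => (B t).biUnion fun a => (ρ t a).toFinset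
  have hPmem : ∀ q, q ∈ P ↔ ∃ t, ∃ a ∈ B t, ρ t a = some q := by
    intro q
    simp [P]
  refine ⟨P, ?_, ?_, ?_⟩
  · refine (Finset.card_biUnion_le_card_mul _ _ (3 * m) fun t _ => ?_).trans (by simp)
    refine (Finset.card_biUnion_le_card_mul _ _ 1 fun a _ => ?_).trans (by simpa using hB t)
    cases ρ t a <;> simp
  · intro p hp
    obtain ⟨t, a, ha, hq⟩ := (hPmem p).1 hp
    obtain ⟨q, hq1, hq2, -⟩ := hρ t a (hBsub t ha)
    rw [hq] at hq1
    cases hq1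
    exact hq2
  · intro b hb h hh
    have ha : G.inn h ∈ At (G.src h) := (hAt _ _).2 ⟨h, hh, rfl, rfl⟩
    by_cases haB : G.inn h ∈ B (G.src h)
    · left
      obtain ⟨q, hq1, hq2, hq3, hq4⟩ := hρ _ _ ha
      exact ⟨q.2, (hb q ((hPmem q).2 ⟨_, _, haB, hq1⟩)).mem_tail, hq3, hq4⟩
    · right
      have haA : G.inn h ∉ A₁ (G.src h) := fun h' => haB (Finset.mem_union_left _ h')
      refine ⟨A₁ (G.src h), ?_, ?_⟩
      · rcases hor (G.src h) with h1 | h1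
        · exact h1.ge
        · exact absurd (h1 ▸ ha) haA
      · intro c hc
        obtain ⟨q, hq1, hq2, hq3, hq4⟩ := hρ _ _ (hsub _ hc)
        refine ⟨q.1, q.2, hb q ((hPmem q).2 ⟨_, _, Finset.mem_union_left _ hc, hq1⟩), hq3, ?_, hq4⟩
        intro hout
        refine haB (Finset.mem_union_right _ (Finset.mem_inter.2 ⟨ha, ?_⟩))
        exact Finset.mem_biUnion.2 ⟨c, hc, by rw [hq1]; exact hout⟩

/-- Every linked word is, up to the order of its letters, a linked word of bounded length together
with cycles of bounded length that it absorbs. -/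
theorem exists_decomposition [Fintype T] (G : LinkSystem Λ T A) (m : ℕ) :
    ∃ K, ∀ s, G.Linked s →
      ∃ (b : List Λ) (zs : List (List Λ)), G.Linked b ∧ b.head? = s.head? ∧
      b.getLast? = s.getLast? ∧ b.length ≤ K ∧ s.Perm (b ++ zs.flatten) ∧
      ∀ z ∈ zs, G.IsCycle z ∧ z.length ≤ K ∧ ∀ h ∈ z.head?, G.Absorbs m b h := by
  classical
  refine ⟨(Fintype.card T * (3 * m) + 1) * (5 * Fintype.card T + 1), fun s hs => ?_⟩
  obtain ⟨P, hP1, hP2, hP3⟩ := exists_absorbing_pairs (G := G) m s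
  obtain ⟨b, zs, h1, h2, h3, h4, h5, h6, h7⟩ := hs.exists_reduced_retaining P hP2
  refine ⟨b, zs, h1, h2, h3, h4.trans (Nat.mul_le_mul_right _ (by omega)), h5, fun z hz => ?_⟩
  obtain ⟨c1, c2, c3⟩ := h7 z hz
  exact ⟨c1, c2.trans (Nat.le_mul_of_pos_left _ (by omega)), fun h hh => hP3 b h6 h (c3 h hh)⟩

end LinkSystem

/-! ### Reassembling a linked word from a short word and the cycles it absorbs -/

namespace LinkSystem

variable {Λ T A : Type*} {G : LinkSystem Λ T A}

theorem IsCycle.linked_left {z : List Λ} (h : G.IsCycle z) : G.Linked z :=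
  (linked_append.1 h.linked).1

theorem IsCycle.link {z : List Λ} (h : G.IsCycle z) {x y : Λ} (hx : z.getLast? = some x)
    (hy : z.head? = some y) : G.Link x y :=
  (linked_append.1 h.linked).2.2 x hx y hy

variable (G) in
/-- A linked word that starts in the state in which it ends.  In contrast to a cycle, its last
letter may forbid the atom of its first letter. -/
structure IsLoop (z : List Λ) : Prop where
  ne_nil : z ≠ []
  linked : G.Linked z
  closed : ∀ x ∈ z.getLast?, ∀ y ∈ z.head?, G.tgt x = G.src y

theorem IsCycle.isLoop {z : List Λ} (h : G.IsCycle z) : G.IsLoop z :=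
  ⟨h.ne_nil, h.linked_left, fun _ hx _ hy => (h.link hx hy).1⟩

theorem IsLoop.append {z z' : List Λ} (h : G.IsLoop z) (h' : G.IsLoop z')
    (hl : ∀ x ∈ z.getLast?, ∀ y ∈ z'.head?, G.Link x y) : G.IsLoop (z ++ z') := by
  obtain ⟨a, l, rfl⟩ := List.exists_cons_of_ne_nil h.ne_nil
  refine ⟨by simp, linked_append.2 ⟨h.linked, h'.linked, hl⟩, fun x hx y hy => ?_⟩
  rw [List.getLast?_append_of_ne_nil _ h'.ne_nil] at hx
  simp only [List.cons_append, List.head?_cons, Option.mem_def, Option.some.injEq] at hy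
  subst hy
  obtain ⟨c, hc⟩ := Option.ne_none_iff_exists'.1 (mt List.head?_eq_none_iff.1 h'.ne_nil)
  obtain ⟨g, hg⟩ := Option.ne_none_iff_exists'.1 (mt List.getLast?_eq_none_iff.1 h.ne_nil)
  rw [h'.closed x hx c hc, ← (hl g hg c hc).1]
  exact h.closed g hg a (by simp)

/-- Cycles can be merged into a number of loops that depends on the control states only.  Cycles
with equal first atoms are concatenated directly; among loops from one control state with more than
three distinct first atoms, some loop may follow another one. -/
theorem exists_loops [Fintype T] (zs : List (List Λ)) (hzs : ∀ z ∈ zs, G.IsCycle z) :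
    ∃ us : List (List Λ), us.length ≤ Fintype.card T * 3 ∧ us.flatten.Perm zs.flatten ∧
      us.Pairwise (fun u u' => ∀ x ∈ u.head?, ∀ y ∈ u'.head?,
        ¬ (G.src x = G.src y ∧ G.inn x = G.inn y)) ∧
      ∀ u ∈ us, G.IsLoop u ∧ ∃ z ∈ zs, u.head? = z.head? := by
  classical
  induction zs with
  | nil => exact ⟨[], by simp, by simp, List.Pairwise.nil, by simp⟩
  | cons z zs ih =>
    obtain ⟨us, h1, h2, h3, h4⟩ := ih fun z hz => hzs z (List.mem_cons_of_mem _ hz)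
    have hz := hzs z List.mem_cons_self
    obtain ⟨g, hg⟩ := Option.ne_none_iff_exists'.1 (mt List.head?_eq_none_iff.1 hz.ne_nil)
    have hsymm : ∀ {u u' : List Λ}, (∀ x ∈ u.head?, ∀ y ∈ u'.head?,
        ¬ (G.src x = G.src y ∧ G.inn x = G.inn y)) → (∀ x ∈ u'.head?, ∀ y ∈ u.head?,
        ¬ (G.src x = G.src y ∧ G.inn x = G.inn y)) :=
      fun h x hx y hy hxy => h y hy x hx ⟨hxy.1.symm, hxy.2.symm⟩
    by_cases hex : ∃ u ∈ us, ∃ h ∈ u.head?, G.src h = G.src g ∧ G.inn h = G.inn g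
    · obtain ⟨u, hu, h, hh, hs, ha⟩ := hex
      have hp := List.perm_cons_erase hu
      rw [hp.pairwise_iff hsymm, List.pairwise_cons] at h3
      obtain ⟨hul, -⟩ := h4 u hu
      have hhead : (z ++ u).head? = some g := by rw [List.head?_append, hg]; rfl
      refine ⟨(z ++ u) :: us.erase u, ?_, ?_, ?_, ?_⟩
      · rw [List.length_cons]; rw [hp.length_eq, List.length_cons] at h1; exact h1
      · rw [List.flatten_cons, List.flatten_cons, List.append_assoc]
        refine List.Perm.append_left _ (List.Perm.trans ?_ h2)
        rw [← List.flatten_cons]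
        exact hp.symm.flatten
      · refine List.pairwise_cons.2 ⟨fun u' hu' x hx y hy hxy => ?_, h3.2⟩
        rw [hhead] at hx
        cases hx
        exact h3.1 u' hu' h hh y hy ⟨hs.trans hxy.1, ha.trans hxy.2⟩
      · intro u' hu'
        rcases List.mem_cons.1 hu' with rfl | hu'
        · refine ⟨hz.isLoop.append hul fun x hx y hy => ?_, z, List.mem_cons_self, hhead.trans hg.symm⟩
          have := hz.link hx hg
          cases hh.symm.trans hy
          exact ⟨this.1.trans hs.symm, ha ▸ this.2⟩
        · obtain ⟨c1, z', hz', c2⟩ := h4 u' (List.mem_of_mem_erase hu')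
          exact ⟨c1, z', List.mem_cons_of_mem _ hz', c2⟩
    push Not at hex
    have h3' : (z :: us).Pairwise (fun u u' => ∀ x ∈ u.head?, ∀ y ∈ u'.head?,
        ¬ (G.src x = G.src y ∧ G.inn x = G.inn y)) := by
      refine List.pairwise_cons.2 ⟨fun u' hu' x hx y hy hxy => ?_, h3⟩
      cases hg.symm.trans hx
      exact hex u' hu' y hy hxy.1.symm hxy.2.symm
    have h4' : ∀ u ∈ z :: us, G.IsLoop u ∧ ∃ z' ∈ z :: zs, u.head? = z'.head? := by
      intro u hu
      rcases List.mem_cons.1 hu with rfl | hu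
      · exact ⟨hz.isLoop, _, List.mem_cons_self, rfl⟩
      · obtain ⟨c1, z', hz', c2⟩ := h4 u hu
        exact ⟨c1, z', List.mem_cons_of_mem _ hz', c2⟩
    have h2' : (z :: us).flatten.Perm (z :: zs).flatten := by
      rw [List.flatten_cons, List.flatten_cons]
      exact h2.append_left _
    by_cases hlen : (z :: us).length ≤ Fintype.card T * 3
    · exact ⟨z :: us, hlen, h2', h3', h4'⟩
    generalize hvs : z :: us = vs at *
    have hvlen : vs.length ≤ Fintype.card T * 3 + 1 := by rw [← hvs]; simpa using h1
    have hne : ∀ u ∈ vs, ∃ h, u.head? = some h := fun u hu =>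
      Option.ne_none_iff_exists'.1 (mt List.head?_eq_none_iff.1 (h4' u hu).1.ne_nil)
    have hinj : ∀ u ∈ vs, ∀ u' ∈ vs, u.head?.map G.src = u'.head?.map G.src →
        u.head?.map G.inn = u'.head?.map G.inn → u = u' := by
      intro u hu u' hu' e1 e2
      by_contra hcon
      obtain ⟨h, hh⟩ := hne u hu
      obtain ⟨h', hh'⟩ := hne u' hu'
      have : Std.Symm (fun u u' : List Λ => ∀ x ∈ u.head?, ∀ y ∈ u'.head?,
          ¬ (G.src x = G.src y ∧ G.inn x = G.inn y)) := ⟨fun _ _ => hsymm⟩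
      have := h3'.forall hu hu' hcon h hh h' hh'
      simp only [hh, hh', Option.map_some, Option.some.injEq] at e1 e2
      exact this ⟨e1, e2⟩
    have hnodup : vs.Nodup := by
      refine h3'.imp_of_mem fun {u u'} hu _ h huu => ?_
      subst huu
      obtain ⟨c, hc⟩ := hne u hu
      exact h c hc c hc ⟨rfl, rfl⟩
    -- More than three loops leave from one control state.
    obtain ⟨t, -, ht⟩ := Finset.exists_lt_card_fiber_of_mul_lt_card_of_maps_to
      (s := vs.toFinset) (t := Finset.univ.image (some : T → Option T))
      (f := fun u => u.head?.map G.src) (n := 3)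
      (fun u hu => by
        obtain ⟨h, hh⟩ := hne u (List.mem_toFinset.1 hu)
        simp [hh])
      (by
        rw [Finset.card_image_of_injective _ (Option.some_injective _),
          List.toFinset_card_of_nodup hnodup, Finset.card_univ]
        exact not_le.1 hlen)
    set W := vs.toFinset.filter fun u => u.head?.map G.src = t with hW
    obtain ⟨u, hu⟩ := Finset.card_pos.1 (lt_of_le_of_lt (Nat.zero_le 3) ht)
    obtain ⟨hu1, hu2⟩ := Finset.mem_filter.1 hu
    rw [List.mem_toFinset] at hu1
    have hul := (h4' u hu1).1
    obtain ⟨h, hh⟩ := hne u hu1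
    obtain ⟨l, hl⟩ := Option.ne_none_iff_exists'.1 (mt List.getLast?_eq_none_iff.1 hul.ne_nil)
    -- One of the other loops starts with an atom that the last letter of `u` does not forbid.
    obtain ⟨a, ha, ha'⟩ := Finset.exists_mem_notMem_of_card_lt_card
      (s := (G.out l).image some) (t := (W.erase u).image fun u => u.head?.map G.inn) (by
        rw [Finset.card_image_of_injective _ (Option.some_injective _),
          Finset.card_image_of_injOn (s := W.erase u), Finset.card_erase_of_mem hu]
        · have := G.card_out_le l
          omega
        · intro v hv v' hv' e
          simp only [Finset.coe_erase, hW, Finset.coe_filter, List.mem_toFinset, Set.mem_sdiff,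
            Set.mem_ofPred_eq] at hv hv'
          exact hinj v hv.1.1 v' hv'.1.1 (hv.1.2.trans hv'.1.2.symm) e)
    obtain ⟨u', hu', rfl⟩ := Finset.mem_image.1 ha
    obtain ⟨hne', hu'W⟩ := Finset.mem_erase.1 hu'
    obtain ⟨hu'1, hu'2⟩ := Finset.mem_filter.1 hu'W
    rw [List.mem_toFinset] at hu'1
    obtain ⟨h', hh'⟩ := hne u' hu'1
    have hp : vs.Perm (u :: u' :: (vs.erase u).erase u') :=
      (List.perm_cons_erase hu1).trans
        ((List.perm_cons_erase ((List.mem_erase_of_ne hne').2 hu'1)).cons _)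
    have hul' := (h4' u' hu'1).1
    have hhead : (u ++ u').head? = some h := by rw [List.head?_append, hh]; rfl
    rw [hp.pairwise_iff hsymm, List.pairwise_cons, List.pairwise_cons] at h3'
    refine ⟨(u ++ u') :: (vs.erase u).erase u', ?_, ?_, ?_, ?_⟩
    · rw [hp.length_eq] at hvlen
      simpa using hvlen
    · refine List.Perm.trans ?_ h2'
      refine List.Perm.trans ?_ hp.symm.flatten
      simp
    · refine List.pairwise_cons.2 ⟨fun v hv x hx y hy => ?_, h3'.2.2⟩
      rw [hhead, ← hh] at hx
      exact h3'.1 v (List.mem_cons_of_mem _ hv) x hx y hy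
    · intro v hv
      rcases List.mem_cons.1 hv with rfl | hv
      · refine ⟨hul.append hul' fun x hx y hy => ?_, ?_⟩
        · cases hl.symm.trans hx
          cases hh'.symm.trans hy
          refine ⟨(hul.closed l hl h hh).trans ?_, fun hmem => ha' ?_⟩
          · have := hu2.trans hu'2.symm
            simpa [hh, hh'] using this
          · rw [hh']
            exact Finset.mem_image_of_mem _ hmem
        · obtain ⟨-, z', hz', e⟩ := h4' u hu1
          exact ⟨z', hz', by rw [hhead, ← hh, e]⟩
      · exact h4' v (List.mem_of_mem_erase (List.mem_of_mem_erase hv))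

/-- Insertion of `z` between the adjacent letters `x` and `y` keeps all other adjacent pairs. -/
theorem Linked.exists_insert {s z : List Λ} (hs : G.Linked s) (hz : G.Linked z) {x y h l : Λ}
    (hxy : Adj s x y) (hh : z.head? = some h) (hl : z.getLast? = some l) (hxh : G.Link x h)
    (hly : G.Link l y) :
    ∃ s', G.Linked s' ∧ s'.head? = s.head? ∧ s'.getLast? = s.getLast? ∧ s'.Perm (s ++ z) ∧
      (∀ c ∈ s.tail, c ∈ s'.tail) ∧ ∀ p q, Adj s p q → Adj s' p q ∨ (p = x ∧ q = y) := by
  obtain ⟨a, b, rfl⟩ := hxy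
  have hcut : a ++ x :: y :: b = (a ++ [x]) ++ (y :: b) := by simp
  have hx : (a ++ [x]).getLast? = some x := by simp
  rw [hcut] at hs ⊢
  obtain ⟨v1, v2, -⟩ := linked_append.1 hs
  refine ⟨(a ++ [x]) ++ (z ++ (y :: b)), linked_append.2 ⟨v1, linked_append.2 ⟨hz, v2, ?_⟩, ?_⟩,
    ?_, ?_, ?_, ?_, ?_⟩
  · intro p hp q hq
    cases hl.symm.trans hp
    simp only [List.head?_cons, Option.mem_def, Option.some.injEq] at hq
    exact hq ▸ hly
  · intro p hp q hq
    cases hx.symm.trans hp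
    rw [List.head?_append, hh] at hq
    cases hq
    exact hxh
  · cases a <;> simp
  · rw [← List.append_assoc, List.getLast?_append_of_ne_nil _ (List.cons_ne_nil y b),
      List.getLast?_append_of_ne_nil _ (List.cons_ne_nil y b)]
  · rw [List.append_assoc (a ++ [x])]
    exact List.perm_append_comm.append_left _
  · intro c hc
    rw [List.tail_append_of_ne_nil (by simp), List.mem_append] at hc ⊢
    rw [List.mem_append]
    tauto
  · intro p q hpq
    rw [adj_append] at hpq
    rw [adj_append, adj_append (l := z)]
    rcases hpq with h | h | ⟨h1, h2⟩
    · exact Or.inl (Or.inl h)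
    · exact Or.inl (Or.inr (Or.inl (Or.inr (Or.inl h))))
    · right
      cases hx.symm.trans h1
      simp only [List.head?_cons, Option.some.injEq] at h2
      exact ⟨rfl, h2.symm⟩

/-- A number of loops can be inserted into a word that has more than enough room for each. -/
theorem Linked.exists_insert_loops (us : List (List Λ)) {s : List Λ} (hs : G.Linked s)
    (hus : ∀ u ∈ us, G.IsLoop u ∧ ∀ h ∈ u.head?,
      G.Roomy (us.length + 2) s (G.src h) (G.inn h)) :
    ∃ s', G.Linked s' ∧ s'.head? = s.head? ∧ s'.getLast? = s.getLast? ∧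
      s'.Perm (s ++ us.flatten) ∧ ∀ c ∈ s.tail, c ∈ s'.tail := by
  classical
  induction us generalizing s with
  | nil => exact ⟨s, hs, rfl, rfl, by simp, fun _ h => h⟩
  | cons u us ih =>
    obtain ⟨hu, hroom⟩ := hus u List.mem_cons_self
    obtain ⟨h, hh⟩ := Option.ne_none_iff_exists'.1 (mt List.head?_eq_none_iff.1 hu.ne_nil)
    obtain ⟨l, hl⟩ := Option.ne_none_iff_exists'.1 (mt List.getLast?_eq_none_iff.1 hu.ne_nil)
    obtain ⟨F, hF, hF'⟩ := hroom h hh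
    have hlt : (G.out l).card < F.card := by
      have := G.card_out_le l
      rw [List.length_cons] at hF
      omega
    obtain ⟨c, hc, hcl⟩ := Finset.exists_mem_notMem_of_card_lt_card hlt
    obtain ⟨x, y, hxy, hy, hx, rfl⟩ := hF' c hc
    have hlink := hs.link_of_adj hxy
    obtain ⟨s', a1, a2, a3, a4, a5, a6⟩ := hs.exists_insert hu.linked hxy hh hl
      ⟨hlink.1.trans hy, hx⟩ ⟨(hu.closed l hl h hh).trans hy.symm, hcl⟩
    obtain ⟨s'', c1, c2, c3, c4, c5⟩ := ih a1 fun u' hu' => by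
      obtain ⟨d1, d2⟩ := hus u' (List.mem_cons_of_mem _ hu')
      refine ⟨d1, fun h' hh' => ?_⟩
      obtain ⟨F, hF, hF'⟩ := d2 h' hh'
      refine ⟨F.erase (G.inn y), ?_, fun c hc => ?_⟩
      · have := Finset.pred_card_le_card_erase (s := F) (a := G.inn y)
        rw [List.length_cons] at hF
        omega
      · obtain ⟨hne, hcF⟩ := Finset.mem_erase.1 hc
        obtain ⟨p, q, e1, e2, e3, e4⟩ := hF' c hcF
        rcases a6 p q e1 with e | ⟨-, rfl⟩
        · exact ⟨p, q, e, e2, e3, e4⟩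
        · exact absurd e4.symm hne
    refine ⟨s'', c1, c2.trans a2, c3.trans a3, ?_, fun c hc => c5 c (a5 c hc)⟩
    rw [List.flatten_cons, ← List.append_assoc]
    exact c4.trans (a4.append_right _)

/-- Cycles whose first atom and state occur in a word can be inserted one after another. -/
theorem Linked.exists_insert_cycles (zs : List (List Λ)) {s : List Λ} (hs : G.Linked s)
    (hzs : ∀ z ∈ zs, G.IsCycle z ∧ ∀ h ∈ z.head?, ∃ l ∈ s.tail,
      G.src l = G.src h ∧ G.inn l = G.inn h) :
    ∃ s', G.Linked s' ∧ s'.head? = s.head? ∧ s'.getLast? = s.getLast? ∧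
      s'.Perm (s ++ zs.flatten) := by
  induction zs generalizing s with
  | nil => exact ⟨s, hs, rfl, rfl, by simp⟩
  | cons z zs ih =>
    obtain ⟨hz, hocc⟩ := hzs z List.mem_cons_self
    obtain ⟨h, hh⟩ := Option.ne_none_iff_exists'.1 (mt List.head?_eq_none_iff.1 hz.ne_nil)
    obtain ⟨l, hl⟩ := Option.ne_none_iff_exists'.1 (mt List.getLast?_eq_none_iff.1 hz.ne_nil)
    obtain ⟨y, hy, e1, e2⟩ := hocc h hh
    obtain ⟨x, hxy⟩ := exists_adj_of_mem_tail hy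
    have hlink := hs.link_of_adj hxy
    have hlh := hz.link hl hh
    obtain ⟨s', a1, a2, a3, a4, a5, -⟩ := hs.exists_insert hz.linked_left hxy hh hl
      ⟨hlink.1.trans e1, e2 ▸ hlink.2⟩ ⟨hlh.1.trans e1.symm, e2.symm ▸ hlh.2⟩
    obtain ⟨s'', c1, c2, c3, c4⟩ := ih a1 fun z' hz' => by
      obtain ⟨d1, d2⟩ := hzs z' (List.mem_cons_of_mem _ hz')
      refine ⟨d1, fun h' hh' => ?_⟩
      obtain ⟨l', hl', e⟩ := d2 h' hh'
      exact ⟨l', a5 l' hl', e⟩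
    refine ⟨s'', c1, c2.trans a2, c3.trans a3, ?_⟩
    rw [List.flatten_cons, ← List.append_assoc]
    exact c4.trans (a4.append_right _)

theorem Roomy.mono {m m' : ℕ} (h : m ≤ m') {s : List Λ} {t : T} {a : A} (hr : G.Roomy m' s t a) :
    G.Roomy m s t a := by
  obtain ⟨F, h1, h2⟩ := hr
  exact ⟨F, h.trans h1, h2⟩

/-- A linked word and any cycles it absorbs make up a linked word. -/
theorem Linked.exists_absorb [Fintype T] {b : List Λ} (hb : G.Linked b) (zs : List (List Λ))
    (hzs : ∀ z ∈ zs, G.IsCycle z ∧ ∀ h ∈ z.head?, G.Absorbs (Fintype.card T * 3 + 2) b h) :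
    ∃ s, G.Linked s ∧ s.head? = b.head? ∧ s.getLast? = b.getLast? ∧
      s.Perm (b ++ zs.flatten) := by
  classical
  let p : List Λ → Bool := fun z => decide (∀ h ∈ z.head?,
    G.Roomy (Fintype.card T * 3 + 2) b (G.src h) (G.inn h))
  obtain ⟨us, h1, h2, -, h4⟩ := exists_loops (zs.filter p)
    (fun z hz => (hzs z (List.mem_filter.1 hz).1).1)
  obtain ⟨s, a1, a2, a3, a4, a5⟩ := hb.exists_insert_loops us fun u hu => by
    obtain ⟨c1, z, hz, c2⟩ := h4 u hu
    refine ⟨c1, fun h hh => ?_⟩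
    have := of_decide_eq_true (List.mem_filter.1 hz).2 h (c2 ▸ hh)
    exact this.mono (by omega)
  obtain ⟨s', c1, c2, c3, c4⟩ := a1.exists_insert_cycles (zs.filter fun z => !p z) fun z hz => by
    obtain ⟨hz1, hz2⟩ := List.mem_filter.1 hz
    obtain ⟨d1, d2⟩ := hzs z hz1
    refine ⟨d1, fun h hh => ?_⟩
    rcases d2 h hh with ⟨l, hl, e⟩ | hr
    · exact ⟨l, a5 l hl, e⟩
    · exfalso
      have : p z = true := by
        refine decide_eq_true fun h' hh' => ?_
        cases hh.symm.trans hh'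
        exact hr
      simp [this] at hz2
  refine ⟨s', c1, c2.trans a2, c3.trans a3, c4.trans ?_⟩
  refine (a4.append_right _).trans ?_
  rw [List.append_assoc]
  refine List.Perm.append_left _ ((h2.append_right _).trans ?_)
  rw [← List.flatten_append]
  exact (List.filter_append_perm p zs).flatten

end LinkSystem

/-! ### Closure properties of rational expressions -/

namespace DataVector

variable {H : Type v} {Atoms : Type u}

theorem rename_zero (π : Equiv.Perm Atoms) : rename π (0 : DataVector H Atoms) = 0 :=
  Finsupp.mapDomain_zero

theorem rename_add (π : Equiv.Perm Atoms) (x y : DataVector H Atoms) :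
    rename π (x + y) = rename π x + rename π y :=
  Finsupp.mapDomain_add

theorem rename_single (π : Equiv.Perm Atoms) (h : H) (a : Atoms) (n : ℕ) :
    rename π (Finsupp.single (h, a) n) = Finsupp.single (h, π a) n :=
  Finsupp.mapDomain_single

theorem rename_one (x : DataVector H Atoms) : rename 1 x = x := by
  have : Prod.map id (1 : Equiv.Perm Atoms) = (id : H × Atoms → H × Atoms) := by
    ext ⟨h, a⟩ <;> rfl
  rw [rename, this, Finsupp.mapDomain_id]

theorem rename_mul (π π' : Equiv.Perm Atoms) (x : DataVector H Atoms) :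
    rename (π * π') x = rename π (rename π' x) := by
  rw [rename, rename, rename, ← Finsupp.mapDomain_comp]
  rfl

theorem rename_image_add (π : Equiv.Perm Atoms) (R R' : Set (DataVector H Atoms)) :
    rename π '' (R + R') = rename π '' R + rename π '' R' :=
  Set.image_image2_distrib (rename_add π)

theorem rename_list_sum (π : Equiv.Perm Atoms) (l : List (DataVector H Atoms)) :
    rename π l.sum = (l.map (rename π)).sum := by
  induction l with
  | nil => simp [rename_zero]
  | cons x l ih => simp [rename_add, ih]

theorem rename_image_kleeneStar (π : Equiv.Perm Atoms) (R : Set (DataVector H Atoms)) :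
    rename π '' kleeneStar R = kleeneStar (rename π '' R) := by
  ext x
  constructor
  · rintro ⟨_, ⟨l, hl, rfl⟩, rfl⟩
    refine ⟨l.map (rename π), ?_, (rename_list_sum π l).symm⟩
    intro y hy
    obtain ⟨z, hz, rfl⟩ := List.mem_map.1 hy
    exact ⟨z, hl z hz, rfl⟩
  · rintro ⟨l, hl, rfl⟩
    have : ∃ l' : List (DataVector H Atoms), (∀ y ∈ l', y ∈ R) ∧ l'.map (rename π) = l := by
      induction l with
      | nil => exact ⟨[], by simp, rfl⟩
      | cons y l ih =>
        obtain ⟨l', h1, h2⟩ := ih fun z hz => hl z (List.mem_cons_of_mem _ hz)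
        obtain ⟨z, hz, rfl⟩ := hl y List.mem_cons_self
        exact ⟨z :: l', by simpa using ⟨hz, h1⟩, by simp [h2]⟩
    obtain ⟨l', h1, rfl⟩ := this
    exact ⟨l'.sum, ⟨l', h1, rfl⟩, rename_list_sum π l'⟩

theorem HasRationalExpr.mono {n m : ℕ} (hnm : n ≤ m) {R : Set (DataVector H Atoms)}
    (h : HasRationalExpr n R) : HasRationalExpr m R := by
  induction h generalizing m with
  | zero n => exact .zero m
  | letter n σ => exact .letter m σ
  | add _ _ ih ih' => exact (ih hnm).add (ih' hnm)
  | kleeneStar _ ih =>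
    obtain ⟨m, rfl⟩ := Nat.exists_eq_succ_of_ne_zero (n := m) (by omega)
    exact (ih (Nat.le_of_succ_le_succ hnm)).kleeneStar
  | orbitFiniteUnion X f hX hf _ ih => exact .orbitFiniteUnion X f hX hf fun x hx => ih x hx hnm

theorem HasRationalExpr.isRational {n : ℕ} {R : Set (DataVector H Atoms)}
    (h : HasRationalExpr n R) : IsRational R := by
  induction h with
  | zero n => exact .zero
  | letter n σ => exact .letter σ
  | add _ _ ih ih' => exact ih.add ih'
  | kleeneStar _ ih => exact ih.kleeneStar
  | orbitFiniteUnion X f hX hf _ ih => exact .orbitFiniteUnion X f hX hf ih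

theorem mem_fixingSubgroup_union {S S' : Set Atoms} {π : Equiv.Perm Atoms} :
    π ∈ fixingSubgroup (Equiv.Perm Atoms) (S ∪ S') ↔
      π ∈ fixingSubgroup (Equiv.Perm Atoms) S ∧ π ∈ fixingSubgroup (Equiv.Perm Atoms) S' := by
  simp only [mem_fixingSubgroup_iff, Set.mem_union]
  exact ⟨fun h => ⟨fun a ha => h a (Or.inl ha), fun a ha => h a (Or.inr ha)⟩,
    fun h a ha => ha.elim (h.1 a) (h.2 a)⟩

/-- Sets with a rational expression are finitely supported. -/
theorem HasRationalExpr.exists_support {n : ℕ} {R : Set (DataVector H Atoms)}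
    (h : HasRationalExpr n R) :
    ∃ S : Set Atoms, S.Finite ∧ ∀ π ∈ fixingSubgroup (Equiv.Perm Atoms) S, rename π '' R = R := by
  induction h with
  | zero n => exact ⟨∅, Set.finite_empty, fun π _ => by simp [rename_zero]⟩
  | letter n σ =>
    refine ⟨{σ.2}, Set.finite_singleton _, fun π hπ => ?_⟩
    have : π σ.2 = σ.2 := (mem_fixingSubgroup_iff _).1 hπ σ.2 rfl
    rw [Set.image_singleton, rename_single, this]
  | add _ _ ih ih' =>
    obtain ⟨S, hS, h⟩ := ih
    obtain ⟨S', hS', h'⟩ := ih'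
    refine ⟨S ∪ S', hS.union hS', fun π hπ => ?_⟩
    obtain ⟨h1, h2⟩ := mem_fixingSubgroup_union.1 hπ
    rw [rename_image_add, h π h1, h' π h2]
  | kleeneStar _ ih =>
    obtain ⟨S, hS, h⟩ := ih
    exact ⟨S, hS, fun π hπ => by rw [rename_image_kleeneStar, h π hπ]⟩
  | orbitFiniteUnion X f hX hf _ ih =>
    obtain ⟨S, hS, h⟩ := hf
    have key : ∀ π ∈ fixingSubgroup (Equiv.Perm Atoms) S,
        rename π '' (⋃ x ∈ X, f x) ⊆ ⋃ x ∈ X, f x := by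
      rintro π hπ _ ⟨y, hy, rfl⟩
      obtain ⟨x, hx, hy⟩ := Set.mem_iUnion₂.1 hy
      obtain ⟨h1, h2⟩ := h π hπ x hx
      exact Set.mem_iUnion₂.2 ⟨π • x, h1, h2 ▸ ⟨y, hy, rfl⟩⟩
    refine ⟨S, hS, fun π hπ => (key π hπ).antisymm fun y hy => ?_⟩
    refine ⟨rename π⁻¹ y, key π⁻¹ (inv_mem hπ) ⟨y, hy, rfl⟩, ?_⟩
    rw [← rename_mul, mul_inv_cancel, rename_one]

theorem HasRationalExpr.empty (n : ℕ) : HasRationalExpr n (∅ : Set (DataVector H Atoms)) := by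
  have := HasRationalExpr.orbitFiniteUnion (n := n) (ι := Atoms) ∅
    (fun _ => (∅ : Set (DataVector H Atoms)))
    ⟨by simp, ∅, Set.finite_empty, ∅, Set.finite_empty, by simp⟩
    ⟨∅, Set.finite_empty, by simp⟩ (by simp)
  simpa using this

theorem HasRationalExpr.union {n : ℕ} {R R' : Set (DataVector H Atoms)}
    (h : HasRationalExpr n R) (h' : HasRationalExpr n R') : HasRationalExpr n (R ∪ R') := by
  let _ : MulAction (Equiv.Perm Atoms) (ULift.{u} Bool) :=
    { smul := fun _ x => x, one_smul := fun _ => rfl, mul_smul := fun _ _ _ => rfl }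
  have hsmul : ∀ (π : Equiv.Perm Atoms) (x : ULift.{u} Bool), π • x = x := fun _ _ => rfl
  obtain ⟨S, hS, hR⟩ := h.exists_support
  obtain ⟨S', hS', hR'⟩ := h'.exists_support
  have := HasRationalExpr.orbitFiniteUnion (n := n) (ι := ULift.{u} Bool) Set.univ
    (fun i => if i.down then R else R')
    ⟨fun x _ => ⟨∅, Set.finite_empty, fun π _ => hsmul π x⟩, ∅, Set.finite_empty, Set.univ,
      Set.finite_univ, (Set.eq_univ_of_forall fun x =>
        Set.mem_iUnion₂.2 ⟨x, trivial, MulAction.mem_orbit_self x⟩).symm⟩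
    ⟨S ∪ S', hS.union hS', fun π hπ x _ => by
      obtain ⟨h1, h2⟩ := mem_fixingSubgroup_union.1 hπ
      refine ⟨trivial, ?_⟩
      rw [hsmul]
      dsimp only
      split_ifs
      · exact (hR π h1).symm
      · exact (hR' π h2).symm⟩
    (fun x _ => by split_ifs; exacts [h, h'])
  convert this using 1
  ext x
  simp [ULift.exists]
  tauto

theorem HasRationalExpr.biUnion {n : ℕ} {κ : Type*} {X : Set κ} (hX : X.Finite)
    {f : κ → Set (DataVector H Atoms)} (h : ∀ x ∈ X, HasRationalExpr n (f x)) :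
    HasRationalExpr n (⋃ x ∈ X, f x) := by
  induction X, hX using Set.Finite.induction_on with
  | empty => simpa using HasRationalExpr.empty n
  | insert _ _ ih =>
    rw [Set.biUnion_insert]
    exact (h _ (Set.mem_insert _ _)).union (ih fun x hx => h x (Set.mem_insert_of_mem _ hx))

theorem HasRationalExpr.iUnion {n : ℕ} {κ : Type*} [Finite κ]
    {f : κ → Set (DataVector H Atoms)} (h : ∀ x, HasRationalExpr n (f x)) :
    HasRationalExpr n (⋃ x, f x) := by
  rw [← Set.biUnion_univ]
  exact .biUnion Set.finite_univ fun x _ => h x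

/-- Orbit-finite unions may be indexed by a type in any universe: an orbit is isomorphic to a
set of cosets of a stabilizer. -/
theorem HasRationalExpr.iUnion_of_isOrbitFinite {n : ℕ} {ι : Type w}
    [MulAction (Equiv.Perm Atoms) ι] {X : Set ι} {f : ι → Set (DataVector H Atoms)}
    (hX : IsOrbitFinite Atoms X) (hf : FinitelySupportedOn X f)
    (h : ∀ x ∈ X, HasRationalExpr n (f x)) : HasRationalExpr n (⋃ x ∈ X, f x) := by
  obtain ⟨hsup, S, hS, T, hT, rfl⟩ := hX
  obtain ⟨S', hS', hf⟩ := hf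
  have heq : ⋃ x ∈ ⋃ t ∈ T, MulAction.orbit (fixingSubgroup (Equiv.Perm Atoms) S) t, f x =
      ⋃ t ∈ T, ⋃ x ∈ MulAction.orbit (fixingSubgroup (Equiv.Perm Atoms) S) t, f x := by
    ext y
    simp only [Set.mem_iUnion]
    constructor
    · rintro ⟨x, ⟨t, ht, hx⟩, hy⟩
      exact ⟨t, ht, x, hx, hy⟩
    · rintro ⟨t, ht, x, hx, hy⟩
      exact ⟨x, ⟨t, ht, hx⟩, hy⟩
  rw [heq]
  refine .biUnion hT fun t ht => ?_
  have hsub : ∀ x ∈ MulAction.orbit (fixingSubgroup (Equiv.Perm Atoms) S) t,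
      x ∈ ⋃ t ∈ T, MulAction.orbit (fixingSubgroup (Equiv.Perm Atoms) S) t :=
    fun x hx => Set.mem_iUnion₂.2 ⟨t, ht, hx⟩
  let φ := MulAction.ofQuotientStabilizer (Equiv.Perm Atoms) t
  have hφ : ∀ (π : Equiv.Perm Atoms) x, φ (π • x) = π • φ x :=
    MulAction.ofQuotientStabilizer_smul (Equiv.Perm Atoms) t
  have hinj : Function.Injective φ := MulAction.injective_ofQuotientStabilizer (Equiv.Perm Atoms) t
  let o : Equiv.Perm Atoms ⧸ MulAction.stabilizer (Equiv.Perm Atoms) t :=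
    ((1 : Equiv.Perm Atoms) : _)
  have ho : φ o = t := by
    simp only [φ, o, MulAction.ofQuotientStabilizer_mk, one_smul]
  have horb : ∀ x ∈ MulAction.orbit (fixingSubgroup (Equiv.Perm Atoms) S) o,
      φ x ∈ MulAction.orbit (fixingSubgroup (Equiv.Perm Atoms) S) t := by
    rintro _ ⟨π, rfl⟩
    refine ⟨π, ?_⟩
    have := hφ π.1 o
    rw [ho] at this
    exact this.symm
  have := HasRationalExpr.orbitFiniteUnion (n := n)
    (MulAction.orbit (fixingSubgroup (Equiv.Perm Atoms) S) o) (fun x => f (φ x))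
    ⟨fun x hx => by
      obtain ⟨A, hA, hA'⟩ := hsup (φ x) (hsub _ (horb x hx))
      refine ⟨A, hA, fun π hπ => hinj ?_⟩
      rw [hφ]
      exact hA' π hπ, S, hS, {o}, Set.finite_singleton _, (Set.biUnion_singleton o _).symm⟩
    ⟨S ∪ S', hS.union hS', fun π hπ x hx => by
      obtain ⟨h1, h2⟩ := mem_fixingSubgroup_union.1 hπ
      refine ⟨?_, ?_⟩
      · obtain ⟨π', rfl⟩ := hx
        exact ⟨⟨π, h1⟩ * π', mul_smul _ _ _⟩
      · dsimp only
        rw [hφ]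
        exact (hf π h2 (φ x) (hsub _ (horb x hx))).2⟩
    (fun x hx => h _ (hsub _ (horb x hx)))
  convert this using 1
  ext y
  simp only [Set.mem_iUnion]
  constructor
  · rintro ⟨x, ⟨π, rfl⟩, hy⟩
    refine ⟨π.1 • o, ⟨π, rfl⟩, ?_⟩
    rw [hφ, ho]
    exact hy
  · rintro ⟨x, hx, hy⟩
    exact ⟨φ x, horb x hx, hy⟩

end DataVector

/-! ### Orbit-finiteness of sets of bounded words -/

/-- Any finite set `F` of atoms can be moved into `W ⊇ S` without moving `S`, if `W` has enough room
outside `S`. -/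
theorem exists_perm_fixing_mapsTo {A : Type*} [DecidableEq A] (S F W : Finset A) (hSW : S ⊆ W)
    (hcard : (F \ S).card ≤ (W \ S).card) :
    ∃ π : Equiv.Perm A, (∀ a ∈ S, π a = a) ∧ ∀ a ∈ F, π a ∈ W := by
  obtain ⟨B, hB, hBcard⟩ := Finset.exists_subset_card_eq hcard
  let e : (F \ S : Finset A) ≃ B := Finset.equivOfCardEq hBcard.symm
  let g : (S ∪ F : Finset A) → A := fun x =>
    if hx : (x : A) ∈ S then x else e ⟨x, by
      have := x.2
      rw [Finset.mem_union] at this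
      exact Finset.mem_sdiff.2 ⟨this.resolve_left hx, hx⟩⟩
  have heS : ∀ x, (e x : A) ∉ S := fun x => (Finset.mem_sdiff.1 (hB (e x).2)).2
  have hg : Function.Injective g := by
    intro x y hxy
    simp only [g] at hxy
    split_ifs at hxy with h1 h2 h2
    · exact Subtype.ext hxy
    · exact absurd (hxy ▸ h1) (heS _)
    · exact absurd (hxy ▸ h2) (heS _)
    · have := congrArg Subtype.val (e.injective (Subtype.ext hxy))
      exact Subtype.ext this
  let x : Fin (S ∪ F).card ↪ A :=
    (S ∪ F).equivFin.symm.toEmbedding.trans (Function.Embedding.subtype _)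
  let y : Fin (S ∪ F).card ↪ A := (S ∪ F).equivFin.symm.toEmbedding.trans ⟨g, hg⟩
  obtain ⟨π, hπ⟩ := (Equiv.Perm.isMultiplyPretransitive A (S ∪ F).card).exists_smul_eq x y
  have key : ∀ a (ha : a ∈ S ∪ F), π a = g ⟨a, ha⟩ := by
    intro a ha
    have := DFunLike.congr_fun hπ ((S ∪ F).equivFin ⟨a, ha⟩)
    simpa [x, y] using this
  refine ⟨π, fun a ha => ?_, fun a ha => ?_⟩
  · rw [key a (Finset.mem_union_left _ ha)]
    simp [g, ha]
  · rw [key a (Finset.mem_union_right _ ha)]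
    simp only [g]
    split_ifs with h
    · exact hSW h
    · exact (Finset.mem_sdiff.1 (hB (e _).2)).1

/-- A set of tuples that is invariant under the `S`-permutations is orbit-finite: each tuple can be
moved into a fixed finite set of atoms. -/
theorem isOrbitFinite_of_invariant {Atoms : Type u} [Infinite Atoms] {k : ℕ}
    {X : Set (Fin k → Atoms × Atoms)} {S : Set Atoms} (hS : S.Finite)
    (hX : ∀ π ∈ fixingSubgroup (Equiv.Perm Atoms) S, ∀ x ∈ X, π • x ∈ X) :
    IsOrbitFinite Atoms X := by
  classical
  constructor
  · intro x _
    refine ⟨Set.range (fun j => (x j).1) ∪ Set.range (fun j => (x j).2),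
      (Set.finite_range _).union (Set.finite_range _), fun π hπ => ?_⟩
    funext j
    exact Prod.ext (hπ (Or.inl ⟨j, rfl⟩)) (hπ (Or.inr ⟨j, rfl⟩))
  obtain ⟨W, hSW, hW⟩ := Infinite.exists_superset_card_eq hS.toFinset
    (hS.toFinset.card + 2 * k) (Nat.le_add_right _ _)
  refine ⟨S, hS, X ∩ {x | ∀ j, x j ∈ (W : Set Atoms) ×ˢ (W : Set Atoms)}, ?_, ?_⟩
  · refine Set.Finite.subset (Set.Finite.pi' fun _ => ?_) Set.inter_subset_right
    exact (W.finite_toSet).prod W.finite_toSet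
  ext x
  simp only [Set.mem_iUnion]
  constructor
  · intro hx
    let F : Finset Atoms := Finset.univ.image (fun j => (x j).1) ∪ Finset.univ.image fun j => (x j).2
    have hF : F.card ≤ 2 * k := by
      refine (Finset.card_union_le _ _).trans ?_
      have h1 := Finset.card_image_le (s := Finset.univ) (f := fun j => (x j).1)
      have h2 := Finset.card_image_le (s := Finset.univ) (f := fun j => (x j).2)
      simp only [Finset.card_univ, Fintype.card_fin] at h1 h2
      omega
    obtain ⟨π, hπ1, hπ2⟩ := exists_perm_fixing_mapsTo hS.toFinset F W hSW (by
      rw [Finset.card_sdiff_of_subset hSW, hW]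
      have := Finset.card_le_card (Finset.sdiff_subset (s := F) (t := hS.toFinset))
      omega)
    have hπ : π ∈ fixingSubgroup (Equiv.Perm Atoms) S :=
      (mem_fixingSubgroup_iff _).2 fun a ha => hπ1 a (hS.mem_toFinset.2 ha)
    refine ⟨π • x, ⟨hX π hπ x hx, fun j => ⟨hπ2 _ ?_, hπ2 _ ?_⟩⟩, ⟨π, hπ⟩⁻¹, inv_smul_smul π x⟩
    · exact Finset.mem_union_left _ (Finset.mem_image_of_mem _ (Finset.mem_univ j))
    · exact Finset.mem_union_right _ (Finset.mem_image_of_mem _ (Finset.mem_univ j))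
  · rintro ⟨t, ht, π, rfl⟩
    exact hX π.1 π.2 t ht.1

/-- Renaming the atoms of a letter that consists of an element of `I` and two atoms. -/
def renameLetter {I : Type*} {Atoms : Type u} (π : Equiv.Perm Atoms) (l : I × Atoms × Atoms) :
    I × Atoms × Atoms := (l.1, π l.2.1, π l.2.2)

/-- Unions over the words of bounded length with an invariant property are orbit-finite. -/
theorem DataVector.HasRationalExpr.iUnion_words {H : Type v} {Atoms : Type u} [Infinite Atoms]
    {I : Type*} [Finite I] {n : ℕ} (K : ℕ) {P : List (I × Atoms × Atoms) → Prop}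
    {f : List (I × Atoms × Atoms) → Set (DataVector H Atoms)} {S : Set Atoms} (hS : S.Finite)
    (hP : ∀ π ∈ fixingSubgroup (Equiv.Perm Atoms) S, ∀ s, P s → P (s.map (renameLetter π)))
    (hf : ∀ π ∈ fixingSubgroup (Equiv.Perm Atoms) S, ∀ s, P s →
      rename π '' f s ⊆ f (s.map (renameLetter π)))
    (h : ∀ s, P s → s.length ≤ K → HasRationalExpr n (f s)) :
    HasRationalExpr n (⋃ s ∈ {s | P s ∧ s.length ≤ K}, f s) := by
  have hmap : ∀ {k : ℕ} (i : Fin k → I) (x : Fin k → Atoms × Atoms) (π : Equiv.Perm Atoms),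
      (List.ofFn fun j => (i j, x j)).map (renameLetter π) =
        List.ofFn fun j => (i j, (π • x) j) := by
    intro k i x π
    rw [List.map_ofFn]
    rfl
  have hunion : ⋃ s ∈ {s | P s ∧ s.length ≤ K}, f s =
      ⋃ i : Σ k : Fin (K + 1), Fin k → I,
        ⋃ x ∈ {x : Fin i.1 → Atoms × Atoms | P (List.ofFn fun j => (i.2 j, x j))},
          f (List.ofFn fun j => (i.2 j, x j)) := by
    ext y
    simp only [Set.mem_iUnion, Set.mem_ofPred_eq]
    constructor
    · rintro ⟨s, ⟨hs, hlen⟩, hy⟩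
      refine ⟨⟨⟨s.length, Nat.lt_succ_of_le hlen⟩, fun j => (s.get j).1⟩, fun j => (s.get j).2, ?_⟩
      have : (List.ofFn fun j : Fin s.length => ((s.get j).1, (s.get j).2)) = s :=
        List.ofFn_get s
      exact ⟨this.symm ▸ hs, this.symm ▸ hy⟩
    · rintro ⟨i, x, hx, hy⟩
      exact ⟨_, ⟨hx, by simpa using Nat.lt_succ_iff.1 i.1.2⟩, hy⟩
  rw [hunion]
  refine .iUnion fun i => .iUnion_of_isOrbitFinite (isOrbitFinite_of_invariant hS ?_)
    ⟨S, hS, ?_⟩ ?_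
  · intro π hπ x hx
    have := hP π hπ _ hx
    rw [hmap] at this
    exact this
  · intro π hπ x hx
    have h1 := hP π hπ _ hx
    have h2 := hf π hπ _ hx
    have h3 := hf π⁻¹ (inv_mem hπ) _ h1
    rw [hmap, hmap, inv_smul_smul] at h3
    rw [hmap] at h1 h2
    refine ⟨h1, subset_antisymm (fun y hy => ?_) h2⟩
    exact ⟨rename π⁻¹ y, h3 ⟨y, hy, rfl⟩, by rw [← rename_mul, mul_inv_cancel, rename_one]⟩
  · intro x hx
    exact h _ hx (by simpa using Nat.lt_succ_iff.1 i.1.2)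

/-! ### Rational expressions for linked words -/

namespace LinkSystem

variable {Λ T A : Type*} {G : LinkSystem Λ T A}

variable (G) in
/-- A permutation of the atoms, together with a map of the letters, preserves a link system. -/
structure IsInvariant (π : Equiv.Perm A) (r : Λ → Λ) : Prop where
  src_eq : ∀ l, G.src (r l) = G.src l
  tgt_eq : ∀ l, G.tgt (r l) = G.tgt l
  inn_eq : ∀ l, G.inn (r l) = π (G.inn l)
  mem_out : ∀ l a, π a ∈ G.out (r l) ↔ a ∈ G.out l

variable {π : Equiv.Perm A} {r : Λ → Λ}

theorem IsInvariant.linked_map (h : G.IsInvariant π r) {s : List Λ} (hs : G.Linked s) :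
    G.Linked (s.map r) := by
  refine List.isChain_map_of_isChain r (fun l l' hl => ?_) hs
  exact ⟨by rw [h.tgt_eq, h.src_eq]; exact hl.1, by rw [h.inn_eq, h.mem_out]; exact hl.2⟩

theorem IsInvariant.isCycle_map (h : G.IsInvariant π r) {z : List Λ} (hz : G.IsCycle z) :
    G.IsCycle (z.map r) :=
  ⟨by simpa using hz.ne_nil, by rw [← List.map_append]; exact h.linked_map hz.linked⟩

theorem IsInvariant.absorbs_map (h : G.IsInvariant π r) {m : ℕ} {b : List Λ} {l : Λ}
    (hb : G.Absorbs m b l) : G.Absorbs m (b.map r) (r l) := by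
  rcases hb with ⟨c, hc, h1, h2⟩ | ⟨F, hF, hF'⟩
  · left
    refine ⟨r c, ?_, ?_, ?_⟩
    · rw [← List.map_tail]; exact List.mem_map_of_mem hc
    · rw [h.src_eq, h.src_eq, h1]
    · rw [h.inn_eq, h.inn_eq, h2]
  · right
    refine ⟨F.map π.toEmbedding, by simpa using hF, fun c hc => ?_⟩
    obtain ⟨a, ha, rfl⟩ := Finset.mem_map.1 hc
    obtain ⟨x, y, ⟨s, t, rfl⟩, h1, h2, rfl⟩ := hF' a ha
    refine ⟨r x, r y, ⟨s.map r, t.map r, by simp⟩, ?_, ?_, h.inn_eq y⟩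
    · rw [h.src_eq, h.src_eq, h1]
    · rw [h.inn_eq, h.mem_out]; exact h2

end LinkSystem

namespace DataVector

variable {H : Type v} {Atoms : Type u} {Λ : Type*}

theorem sum_flatten_subset_kleeneStar {N : Λ → Set (DataVector H Atoms)}
    {R : Set (DataVector H Atoms)} (zs : List (List Λ))
    (hR : ∀ z ∈ zs, (z.map N).sum ⊆ R) :
    (zs.flatten.map N).sum ⊆ kleeneStar R := by
  induction zs with
  | nil =>
    intro x hx
    simp only [List.flatten_nil, List.map_nil, List.sum_nil] at hx
    exact ⟨[], by simp, (Set.mem_zero.1 hx).symm⟩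
  | cons z zs ih =>
    rw [List.flatten_cons, List.map_append, List.sum_append]
    rintro _ ⟨y, hy, y', hy', rfl⟩
    obtain ⟨l, hl, rfl⟩ := ih (fun z hz => hR z (List.mem_cons_of_mem _ hz)) hy'
    refine ⟨y :: l, ?_, by simp⟩
    simp only [List.mem_cons, forall_eq_or_imp]
    exact ⟨hR z List.mem_cons_self hy, hl⟩

theorem exists_flatten_of_mem_kleeneStar {N : Λ → Set (DataVector H Atoms)}
    {R : Set (DataVector H Atoms)} {Z : Set (List Λ)}
    (hR : ∀ x ∈ R, ∃ z ∈ Z, x ∈ (z.map N).sum) {x : DataVector H Atoms} (hx : x ∈ kleeneStar R) :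
    ∃ zs : List (List Λ), (∀ z ∈ zs, z ∈ Z) ∧ x ∈ (zs.flatten.map N).sum := by
  obtain ⟨l, hl, rfl⟩ := hx
  induction l with
  | nil => exact ⟨[], by simp, by simp⟩
  | cons y l ih =>
    obtain ⟨zs, h1, h2⟩ := ih fun z hz => hl z (List.mem_cons_of_mem _ hz)
    obtain ⟨z, hz, hy⟩ := hR y (hl y List.mem_cons_self)
    refine ⟨z :: zs, by simpa using ⟨hz, h1⟩, ?_⟩
    rw [List.flatten_cons, List.map_append, List.sum_append, List.sum_cons]
    exact Set.add_mem_add hy h2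

theorem HasRationalExpr.listSum {n : ℕ} {N : Λ → Set (DataVector H Atoms)}
    (hN : ∀ l, HasRationalExpr n (N l)) (s : List Λ) : HasRationalExpr n (s.map N).sum := by
  induction s with
  | nil => exact .zero n
  | cons l s ih => exact (hN l).add ih

theorem rename_image_listSum_subset {N : Λ → Set (DataVector H Atoms)} {π : Equiv.Perm Atoms}
    {r : Λ → Λ} (hN : ∀ l, rename π '' N l ⊆ N (r l)) (s : List Λ) :
    rename π '' (s.map N).sum ⊆ ((s.map r).map N).sum := by
  induction s with
  | nil =>
    rintro _ ⟨x, hx, rfl⟩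
    simp only [List.map_nil, List.sum_nil, Set.mem_zero] at hx ⊢
    rw [hx, rename_zero]
  | cons l s ih =>
    simp only [List.map_cons, List.sum_cons]
    rw [rename_image_add]
    exact Set.add_subset_add (hN l) ih

theorem kleeneStar_mono {R R' : Set (DataVector H Atoms)} (h : R ⊆ R') :
    kleeneStar R ⊆ kleeneStar R' := by
  rintro _ ⟨l, hl, rfl⟩
  exact ⟨l, fun y hy => h (hl y hy), rfl⟩

/-- Let the letters of a link system stand for sets of data vectors given by expressions of
star-height `n`.  The linked words, from given first to given last letters, then define a set
given by an expression of star-height `n + 1`: a sum over bounded words of the star of all bounded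
cycles that the word absorbs. -/
theorem HasRationalExpr.linkedWords [Infinite Atoms] {I T : Type*} [Finite I] [Finite T]
    (G : LinkSystem (I × Atoms × Atoms) T Atoms) {S : Set Atoms} (hS : S.Finite)
    (hG : ∀ π ∈ fixingSubgroup (Equiv.Perm Atoms) S, G.IsInvariant π (renameLetter π))
    {n : ℕ} {N : I × Atoms × Atoms → Set (DataVector H Atoms)}
    (hN : ∀ l, HasRationalExpr n (N l))
    (hNπ : ∀ π ∈ fixingSubgroup (Equiv.Perm Atoms) S, ∀ l,
      rename π '' N l ⊆ N (renameLetter π l))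
    {first last : I × Atoms × Atoms → Prop}
    (hfirst : ∀ π ∈ fixingSubgroup (Equiv.Perm Atoms) S, ∀ l, first l → first (renameLetter π l))
    (hlast : ∀ π ∈ fixingSubgroup (Equiv.Perm Atoms) S, ∀ l, last l → last (renameLetter π l)) :
    HasRationalExpr (n + 1) {x | ∃ s, G.Linked s ∧ (∃ l ∈ s.head?, first l) ∧
      (∃ l ∈ s.getLast?, last l) ∧ x ∈ (s.map N).sum} := by
  classical
  have := Fintype.ofFinite T
  set m := Fintype.card T * 3 + 2 with hm
  obtain ⟨K, hK⟩ := LinkSystem.exists_decomposition G m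
  let Q : List (I × Atoms × Atoms) → List (I × Atoms × Atoms) → Prop :=
    fun b z => G.IsCycle z ∧ ∀ l ∈ z.head?, G.Absorbs m b l
  let P : List (I × Atoms × Atoms) → Prop :=
    fun b => G.Linked b ∧ (∃ l ∈ b.head?, first l) ∧ ∃ l ∈ b.getLast?, last l
  let R : List (I × Atoms × Atoms) → Set (DataVector H Atoms) :=
    fun b => ⋃ z ∈ {z | Q b z ∧ z.length ≤ K}, (z.map N).sum
  have hQ : ∀ π ∈ fixingSubgroup (Equiv.Perm Atoms) S, ∀ b z, Q b z →
      Q (b.map (renameLetter π)) (z.map (renameLetter π)) := by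
    rintro π hπ b z ⟨h1, h2⟩
    refine ⟨(hG π hπ).isCycle_map h1, fun l hl => ?_⟩
    rw [List.head?_map] at hl
    obtain ⟨l', hl', rfl⟩ := Option.mem_map.1 hl
    exact (hG π hπ).absorbs_map (h2 l' hl')
  have hP : ∀ π ∈ fixingSubgroup (Equiv.Perm Atoms) S, ∀ b, P b →
      P (b.map (renameLetter π)) := by
    rintro π hπ b ⟨h1, ⟨l, hl, h2⟩, ⟨l', hl', h3⟩⟩
    refine ⟨(hG π hπ).linked_map h1, ⟨_, ?_, hfirst π hπ l h2⟩, ⟨_, ?_, hlast π hπ l' h3⟩⟩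
    · rw [List.head?_map]; exact Option.mem_map_of_mem _ hl
    · rw [List.getLast?_map]; exact Option.mem_map_of_mem _ hl'
  have hR : ∀ π ∈ fixingSubgroup (Equiv.Perm Atoms) S, ∀ b,
      rename π '' R b ⊆ R (b.map (renameLetter π)) := by
    rintro π hπ b _ ⟨x, hx, rfl⟩
    obtain ⟨z, ⟨hz, hlen⟩, hx⟩ := Set.mem_iUnion₂.1 hx
    exact Set.mem_iUnion₂.2 ⟨z.map (renameLetter π), ⟨hQ π hπ b z hz, by simpa using hlen⟩,
      rename_image_listSum_subset (hNπ π hπ) z ⟨x, hx, rfl⟩⟩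
  have hRexpr : ∀ b, HasRationalExpr n (R b) := by
    intro b
    let Sb : Set Atoms := ⋃ l ∈ {l | l ∈ b}, {l.2.1, l.2.2}
    have hSb : Sb.Finite := (List.finite_toSet b).biUnion fun l _ => by simp
    refine .iUnion_words K (hS.union hSb) (fun π hπ z hz => ?_) (fun π hπ z _ => ?_)
      (fun z _ _ => .listSum hN z)
    · obtain ⟨h1, h2⟩ := mem_fixingSubgroup_union.1 hπ
      have hb : b.map (renameLetter π) = b := by
        rw [mem_fixingSubgroup_iff] at h2
        conv_rhs => rw [← List.map_id b]
        refine List.map_congr_left fun l hl => ?_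
        have e1 : π l.2.1 = l.2.1 := h2 _ (Set.mem_iUnion₂.2 ⟨l, hl, Or.inl rfl⟩)
        have e2 : π l.2.2 = l.2.2 := h2 _ (Set.mem_iUnion₂.2 ⟨l, hl, Or.inr rfl⟩)
        simp [renameLetter, e1, e2]
      have := hQ π h1 b z hz
      rwa [hb] at this
    · exact rename_image_listSum_subset (hNπ π (mem_fixingSubgroup_union.1 hπ).1) z
  have hunion : {x | ∃ s, G.Linked s ∧ (∃ l ∈ s.head?, first l) ∧
      (∃ l ∈ s.getLast?, last l) ∧ x ∈ (s.map N).sum} =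
      ⋃ b ∈ {b | P b ∧ b.length ≤ K}, ((b.map N).sum + DataVector.kleeneStar (R b)) := by
    ext x
    rw [Set.mem_iUnion₂]
    constructor
    · rintro ⟨s, h1, h2, h3, hx⟩
      obtain ⟨b, zs, a1, a2, a3, a4, a5, a6⟩ := hK s h1
      refine ⟨b, ⟨⟨a1, a2 ▸ h2, a3 ▸ h3⟩, a4⟩, ?_⟩
      rw [(a5.map N).sum_eq, List.map_append, List.sum_append] at hx
      refine Set.add_subset_add subset_rfl (sum_flatten_subset_kleeneStar zs fun z hz y hy => ?_) hx
      obtain ⟨c1, c2, c3⟩ := a6 z hz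
      exact Set.mem_iUnion₂.2 ⟨z, ⟨⟨c1, c3⟩, c2⟩, hy⟩
    · rintro ⟨b, ⟨⟨h1, h2, h3⟩, -⟩, y, hy, y', hy', rfl⟩
      obtain ⟨zs, hzs, hy'⟩ := exists_flatten_of_mem_kleeneStar (Z := {z | Q b z}) (N := N)
        (fun x hx => by
          obtain ⟨z, ⟨hz, -⟩, hx⟩ := Set.mem_iUnion₂.1 hx
          exact ⟨z, hz, hx⟩) hy'
      obtain ⟨s, a1, a2, a3, a4⟩ := h1.exists_absorb zs hzs
      refine ⟨s, a1, a2 ▸ h2, a3 ▸ h3, ?_⟩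
      rw [(a4.map N).sum_eq, List.map_append, List.sum_append]
      exact Set.add_mem_add hy hy'
  rw [hunion]
  refine .iUnion_words K hS hP (fun π hπ b _ => ?_) fun b _ _ =>
    (HasRationalExpr.listSum (fun l => (hN l).mono (Nat.le_succ n)) b).add (hRexpr b).kleeneStar
  rw [rename_image_add, rename_image_kleeneStar]
  exact Set.add_subset_add (rename_image_listSum_subset (hNπ π hπ) b)
    (kleeneStar_mono (hR π hπ b))

end DataVector

/-! ### One-register automata -/

namespace FMA

variable {Atoms : Type u} {H : Type v} {State : Type w}

/-- The assignment of the atom `a` to the only register. -/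
def reg (a : Atoms) : Fin 1 ↪ Atoms := ⟨fun _ => a, fun _ _ _ => Subsingleton.elim _ _⟩

theorem reg_apply_zero (e : Fin 1 ↪ Atoms) : reg (e 0) = e := by
  ext i
  rw [Subsingleton.elim i 0]
  rfl

/-- A transition from the state `q` with register value `a` to the state `q'` with register value
`a'`, reading the letter `(h, b)`. -/
def StepAt (A : FMA 1 Atoms H State) (q : State) (a : Atoms) (h : H) (b : Atoms) (q' : State)
    (a' : Atoms) : Prop :=
  A.Step (q, reg a) (h, b) (q', reg a')

theorem Constraint.holds_perm {D : Finset Atoms} (π : Equiv.Perm Atoms) (hπ : ∀ d ∈ D, π d = d)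
    (a b a' : Atoms) (φ : Constraint 1 D) :
    φ.Holds (reg (π a)) (π b) (reg (π a')) ↔ φ.Holds (reg a) b (reg a') := by
  have hval : ∀ t : Term 1 D, t.val (reg (π a)) (π b) (reg (π a')) =
      π (t.val (reg a) b (reg a')) := by
    intro t
    cases t with
    | reg i => rfl
    | input => rfl
    | next i => rfl
    | const d => exact (hπ d d.2).symm
  induction φ with
  | top => exact Iff.rfl
  | eq s t => simp only [Constraint.Holds, hval, EmbeddingLike.apply_eq_iff_eq]
  | not φ ih => exact not_congr ih
  | and φ ψ ih ih' => exact and_congr ih ih'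
  | or φ ψ ih ih' => exact or_congr ih ih'

theorem StepAt.perm {A : FMA 1 Atoms H State} {π : Equiv.Perm Atoms} (hπ : ∀ d ∈ A.D, π d = d)
    {q : State} {a : Atoms} {h : H} {b : Atoms} {q' : State} {a' : Atoms}
    (hs : A.StepAt q a h b q' a') : A.StepAt q (π a) h (π b) q' (π a') := by
  obtain ⟨φ, h1, h2⟩ := hs
  exact ⟨φ, h1, (φ.holds_perm π hπ a b a').2 h2⟩

/-- If a transition is possible and its next register value is neither distinguished nor equal to
the current value or the input, then any other such next value is possible. -/
theorem StepAt.change_next {A : FMA 1 Atoms H State} {q : State} {a : Atoms} {h : H} {b : Atoms}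
    {q' : State} {a' a'' : Atoms} (hs : A.StepAt q a h b q' a') (h' : a' ∉ A.D) (h'' : a'' ∉ A.D)
    (ha' : a ≠ a') (ha'' : a ≠ a'') (hb' : b ≠ a') (hb'' : b ≠ a'') :
    A.StepAt q a h b q' a'' := by
  classical
  have := hs.perm (π := Equiv.swap a' a'') fun d hd => Equiv.swap_apply_of_ne_of_ne
    (ne_of_mem_of_not_mem hd h') (ne_of_mem_of_not_mem hd h'')
  rwa [Equiv.swap_apply_of_ne_of_ne ha' ha'', Equiv.swap_apply_of_ne_of_ne hb' hb'',
    Equiv.swap_apply_left] at this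

/-- If a transition is possible whose input is stored, and the stored value is neither
distinguished nor equal to the current value, then any other such value is possible. -/
theorem StepAt.change_input {A : FMA 1 Atoms H State} {q : State} {a : Atoms} {h : H}
    {q' : State} {a' a'' : Atoms} (hs : A.StepAt q a h a' q' a') (h' : a' ∉ A.D) (h'' : a'' ∉ A.D)
    (ha' : a ≠ a') (ha'' : a ≠ a'') : A.StepAt q a h a'' q' a'' := by
  classical
  have := hs.perm (π := Equiv.swap a' a'') fun d hd => Equiv.swap_apply_of_ne_of_ne
    (ne_of_mem_of_not_mem hd h') (ne_of_mem_of_not_mem hd h'')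
  rwa [Equiv.swap_apply_of_ne_of_ne ha' ha'', Equiv.swap_apply_left] at this

/-- Runs that keep the register value `a`. -/
inductive BlockRun (A : FMA 1 Atoms H State) (a : Atoms) :
    State → List (H × Atoms) → State → Prop
  | nil (q : State) : A.BlockRun a q [] q
  | cons {q q' q'' : State} {h : H} {b : Atoms} {word : List (H × Atoms)} :
      A.StepAt q a h b q' a → A.BlockRun a q' word q'' → A.BlockRun a q ((h, b) :: word) q''

/-- The data vectors of the runs between two states that keep the register value `a`. -/
def block (A : FMA 1 Atoms H State) (a : Atoms) (q q' : State) : Set (DataVector H Atoms) :=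
  {x | ∃ word, A.BlockRun a q word q' ∧ DataVector.parikh word = x}

end FMA

namespace DataVector

variable {Atoms : Type u} {H : Type v}

theorem parikh_cons (σ : H × Atoms) (word : List (H × Atoms)) :
    parikh (σ :: word) = Finsupp.single σ 1 + parikh word := by
  simp [parikh]

theorem parikh_append (word word' : List (H × Atoms)) :
    parikh (word ++ word') = parikh word + parikh word' := by
  simp [parikh]

end DataVector

namespace FMA

variable {Atoms : Type u} {H : Type v} {State : Type w}

open DataVector

theorem rename_image_block_subset {A : FMA 1 Atoms H State} {π : Equiv.Perm Atoms}
    (hπ : ∀ d ∈ A.D, π d = d) (a : Atoms) (q q' : State) :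
    rename π '' A.block a q q' ⊆ A.block (π a) q q' := by
  rintro _ ⟨_, ⟨word, hrun, rfl⟩, rfl⟩
  induction hrun with
  | nil q => exact ⟨[], .nil q, by simp [parikh, rename_zero]⟩
  | cons hs _ ih =>
    obtain ⟨word', h1, h2⟩ := ih
    refine ⟨_, .cons (hs.perm hπ) h1, ?_⟩
    rw [parikh_cons, parikh_cons, rename_add, rename_single, h2]

variable (Atoms H State) in
/-- Single transitions within a block, as letters: the states, the label and the second atom are
those of the transition, and the first atom is irrelevant. -/
def blockSystem : LinkSystem ((State × H × State) × Atoms × Atoms) State Atoms where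
  src l := l.1.1
  tgt l := l.1.2.2
  inn l := l.2.1
  out _ := ∅
  card_out_le _ := by simp

/-- Register values are constant in a block, so only the control states matter; this is Parikh's
theorem for finite automata. -/
theorem hasRationalExpr_block [Infinite Atoms] [Finite H] [Finite State]
    (A : FMA 1 Atoms H State) (a : Atoms) (q q' : State) :
    HasRationalExpr 1 (A.block a q q') := by
  classical
  let N : (State × H × State) × Atoms × Atoms → Set (DataVector H Atoms) := fun l =>
    if A.StepAt l.1.1 a l.1.2.1 l.2.2 l.1.2.2 a then {Finsupp.single (l.1.2.1, l.2.2) 1} else ∅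
  have hN : ∀ l, HasRationalExpr 0 (N l) := by
    intro l
    simp only [N]
    split_ifs
    · exact .letter 0 _
    · exact .empty 0
  have hS : ((A.D : Set Atoms) ∪ {a}).Finite := A.D.finite_toSet.union (Set.finite_singleton a)
  have key := HasRationalExpr.linkedWords (blockSystem Atoms H State) hS
    (fun π _ => ⟨fun _ => rfl, fun _ => rfl, fun _ => rfl, fun _ _ => by simp [blockSystem]⟩)
    hN (fun π hπ l => by
      obtain ⟨h1, h2⟩ := mem_fixingSubgroup_union.1 hπ
      have hD : ∀ d ∈ A.D, π d = d := fun d hd => (mem_fixingSubgroup_iff _).1 h1 d hd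
      have ha : π a = a := (mem_fixingSubgroup_iff _).1 h2 a rfl
      by_cases h : A.StepAt l.1.1 a l.1.2.1 l.2.2 l.1.2.2 a
      · have h' := h.perm hD
        rw [ha] at h'
        simp [N, h, h', renameLetter, rename_single]
      · simp [N, h])
    (first := fun l => l.1.1 = q) (last := fun l => l.1.2.2 = q')
    (fun _ _ _ h => h) (fun _ _ _ h => h)
  have hzero : HasRationalExpr 1 (if q = q' then {0} else ∅ : Set (DataVector H Atoms)) := by
    split_ifs
    · exact .zero 1
    · exact .empty 1
  convert hzero.union key using 1
  ext x
  constructor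
  · rintro ⟨word, hrun, rfl⟩
    have : (q = q' ∧ word = []) ∨ ∃ s, (blockSystem Atoms H State).Linked s ∧
        (∃ l ∈ s.head?, l.1.1 = q) ∧ (∃ l ∈ s.getLast?, l.1.2.2 = q') ∧
        parikh word ∈ (s.map N).sum := by
      clear key hzero
      induction hrun with
      | nil q => exact Or.inl ⟨rfl, rfl⟩
      | @cons q₁ q₂ q₃ h b word hs _ ih =>
        right
        have hmem : Finsupp.single (h, b) 1 ∈ N ((q₁, h, q₂), a, b) := by simp [N, hs]
        rcases ih with ⟨rfl, rfl⟩ | ⟨s, h1, ⟨l, hl, h2⟩, ⟨l', hl', h3⟩, h4⟩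
        · refine ⟨[((q₁, h, q₂), a, b)], List.isChain_singleton _, ⟨_, rfl, rfl⟩,
            ⟨_, rfl, rfl⟩, ?_⟩
          simpa [parikh] using hmem
        · refine ⟨((q₁, h, q₂), a, b) :: s, ?_, ⟨_, rfl, rfl⟩, ⟨l', ?_, h3⟩, ?_⟩
          · refine LinkSystem.linked_append (l := [((q₁, h, q₂), a, b)]) |>.2
              ⟨List.isChain_singleton _, h1, fun c hc d hd => ?_⟩
            cases hc
            cases hl.symm.trans hd
            exact ⟨h2.symm, by simp [blockSystem]⟩
          · have : s ≠ [] := by rintro rfl; simp at hl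
            rw [← List.singleton_append, List.getLast?_append_of_ne_nil _ this]
            exact hl'
          · rw [parikh_cons, List.map_cons, List.sum_cons]
            exact Set.add_mem_add hmem h4
    rcases this with ⟨rfl, rfl⟩ | h
    · left; simp [parikh]
    · exact Or.inr h
  · rintro (hx | ⟨s, h1, ⟨l, hl, h2⟩, h3, hx⟩)
    · split_ifs at hx with h
      · subst h
        exact ⟨[], .nil q, by rw [Set.mem_singleton_iff.1 hx]; simp [parikh]⟩
      · exact absurd hx (Set.notMem_empty x)
    · clear key hzero
      have hNl : ∀ l x, x ∈ N l → A.StepAt l.1.1 a l.1.2.1 l.2.2 l.1.2.2 a ∧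
          x = Finsupp.single (l.1.2.1, l.2.2) 1 := by
        intro l x hx
        by_cases h : A.StepAt l.1.1 a l.1.2.1 l.2.2 l.1.2.2 a
        · simp only [N, if_pos h, Set.mem_singleton_iff] at hx
          exact ⟨h, hx⟩
        · simp [N, h] at hx
      induction s generalizing l q x with
      | nil => simp at hl
      | cons c s ih =>
        cases hl
        subst h2
        rw [List.map_cons, List.sum_cons] at hx
        obtain ⟨y, hy, z, hz, rfl⟩ := hx
        obtain ⟨hstep, rfl⟩ := hNl _ _ hy
        cases s with
        | nil =>
          obtain ⟨_, hc, rfl⟩ := h3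
          cases hc
          simp only [List.map_nil, List.sum_nil, Set.mem_zero] at hz
          subst hz
          exact ⟨_, .cons hstep (.nil _), by simp [parikh]⟩
        | cons d s =>
          have h1' := List.isChain_cons_cons.1 h1
          obtain ⟨word, hw, rfl⟩ := ih d.1.1 z h1'.2 d rfl rfl h3 hz
          refine ⟨_, .cons hstep (?_ : A.BlockRun a c.1.2.2 word q'), by rw [parikh_cons]⟩
          rw [show c.1.2.2 = d.1.1 from h1'.1.1]
          exact hw

/-- A run on the word from the state `q` with register value `a` to an accepting state. -/
def AcceptsFrom (A : FMA 1 Atoms H State) (q : State) (a : Atoms) (word : List (H × Atoms)) :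
    Prop :=
  ∃ c, A.Run (q, reg a) word c ∧ c.1 ∈ A.accept

theorem StepAt.acceptsFrom {A : FMA 1 Atoms H State} {q : State} {a : Atoms} {h : H} {b : Atoms}
    {q' : State} {a' : Atoms} (hs : A.StepAt q a h b q' a') {word : List (H × Atoms)}
    (hw : A.AcceptsFrom q' a' word) : A.AcceptsFrom q a ((h, b) :: word) := by
  obtain ⟨c, h1, h2⟩ := hw
  exact ⟨c, .cons hs h1, h2⟩

theorem BlockRun.acceptsFrom {A : FMA 1 Atoms H State} {a : Atoms} {q q' : State}
    {word word' : List (H × Atoms)} (hb : A.BlockRun a q word q')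
    (hw : A.AcceptsFrom q' a word') : A.AcceptsFrom q a (word ++ word') := by
  induction hb with
  | nil q => exact hw
  | cons hs _ ih => exact hs.acceptsFrom (ih hw)

/-! ### Runs as linked words of blocks -/

/-- A control state between two blocks: the state of the automaton, the register value if it lies
in `S`, and possibly the label of a pending letter, which the coming block reads together with its
register value. -/
abbrev Port (H : Type v) (State : Type w) (S : Finset Atoms) : Type _ :=
  State × Option S × Option H

/-- A block with its exit, as a letter.  The finite part consists of the entry port, the last state
of the block, the exit port (`none` at the end of the run), and the label of the letter that is
read at the exit, if any.  The first atom is the register value and the second atom is that of the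
letter read at the exit. -/
abbrev BlockLetter (H : Type v) (State : Type w) (S : Finset Atoms) : Type _ :=
  (Port H State S × State × Option (Port H State S) × Option H) × Atoms × Atoms

open Classical in
/-- The atom `a` if it lies in `S`. -/
noncomputable def trace (S : Finset Atoms) (a : Atoms) : Option S :=
  if h : a ∈ S then some ⟨a, h⟩ else none

theorem trace_eq_trace {S : Finset Atoms} {a b : Atoms} (h : trace S a = trace S b) :
    a = b ∨ (a ∉ S ∧ b ∉ S) := by
  unfold trace at h
  split_ifs at h with h1 h2 h2
  · exact Or.inl (congrArg Subtype.val (Option.some.inj h))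
  · exact Or.inr ⟨h1, h2⟩

theorem trace_perm {S : Finset Atoms} {π : Equiv.Perm Atoms} (hπ : ∀ a ∈ S, π a = a) (a : Atoms) :
    trace S (π a) = trace S a := by
  by_cases h : a ∈ S
  · rw [hπ a h]
  · have h' : π a ∉ S := fun h' => h (by rwa [π.injective (hπ _ h')] at h')
    simp [trace, h, h']

open Classical in
/-- Blocks are linked through their ports.  A register value outside `S` must differ from the
preceding register value and from the atom read at the preceding exit. -/
noncomputable def portSystem (H : Type v) (State : Type w) (S : Finset Atoms) :
    LinkSystem (BlockLetter H State S) (Option (Port H State S)) Atoms where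
  src l := some l.1.1
  tgt l := l.1.2.2.1
  inn l := l.2.1
  out l := {l.2.1, l.2.2} \ S
  card_out_le _ := (Finset.card_le_card Finset.sdiff_subset).trans Finset.card_le_two

theorem mem_portSystem_out {S : Finset Atoms} {l : BlockLetter H State S} {a : Atoms} :
    a ∈ (portSystem H State S).out l ↔ (a = l.2.1 ∨ a = l.2.2) ∧ a ∉ S := by
  classical
  simp [portSystem]

theorem portSystem_isInvariant {S : Finset Atoms} {π : Equiv.Perm Atoms}
    (hπ : ∀ a ∈ S, π a = a) : (portSystem H State S).IsInvariant π (renameLetter π) where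
  src_eq _ := rfl
  tgt_eq _ := rfl
  inn_eq _ := rfl
  mem_out l a := by
    rw [mem_portSystem_out, mem_portSystem_out]
    have : π a ∈ S ↔ a ∈ S :=
      ⟨fun h => by rwa [π.injective (hπ _ h)] at h, fun h => by rwa [hπ a h]⟩
    simp [renameLetter, this]

/-- The data vector of an optional letter. -/
noncomputable def optLetter (e : Option H) (a : Atoms) : DataVector H Atoms :=
  e.elim 0 fun h => Finsupp.single (h, a) 1

theorem rename_optLetter (π : Equiv.Perm Atoms) (e : Option H) (a : Atoms) :
    rename π (optLetter e a) = optLetter e (π a) := by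
  cases e with
  | none => exact rename_zero π
  | some h => exact rename_single π h a 1

theorem hasRationalExpr_optLetter (n : ℕ) (e : Option H) (a : Atoms) :
    HasRationalExpr n {optLetter e a} := by
  cases e with
  | none => exact .zero n
  | some h => exact .letter n (h, a)

/-- The exit of a block is consistent: it ends the run, or whichever next register value the link
system admits, there is a transition, whose letter is read at the exit or left pending. -/
def ExitAllowed (A : FMA 1 Atoms H State) (S : Finset Atoms) (l : BlockLetter H State S) : Prop :=
  (l.1.2.2.1 = none ∧ l.1.2.2.2 = none) ∨
  ∃ p κ h, (l.1.2.2.1 = some (p, κ, none) ∧ l.1.2.2.2 = some h ∧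
      ∀ a', trace S a' = κ → a' ∉ (portSystem H State S).out l →
        A.StepAt l.1.2.1 l.2.1 h l.2.2 p a') ∨
    (l.1.2.2.1 = some (p, κ, some h) ∧ l.1.2.2.2 = none ∧
      ∀ a', trace S a' = κ → a' ∉ (portSystem H State S).out l →
        A.StepAt l.1.2.1 l.2.1 h a' p a')

theorem ExitAllowed.perm {A : FMA 1 Atoms H State} {S : Finset Atoms} (hDS : A.D ⊆ S)
    {π : Equiv.Perm Atoms} (hπ : ∀ a ∈ S, π a = a) {l : BlockLetter H State S}
    (h : A.ExitAllowed S l) : A.ExitAllowed S (renameLetter π l) := by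
  have key : ∀ a', trace S a' = trace S (π⁻¹ a') ∧
      (a' ∉ (portSystem H State S).out (renameLetter π l) →
        π⁻¹ a' ∉ (portSystem H State S).out l) := by
    intro a'
    have e : π (π⁻¹ a') = a' := π.apply_symm_apply a'
    constructor
    · conv_lhs => rw [← e]
      exact trace_perm hπ _
    · intro h1 h2
      rw [← (portSystem_isInvariant hπ).mem_out, e] at h2
      exact h1 h2
  have hD : ∀ d ∈ A.D, π d = d := fun d hd => hπ d (hDS hd)
  rcases h with h | ⟨p, κ, h, ⟨h1, h2, h3⟩ | ⟨h1, h2, h3⟩⟩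
  · exact Or.inl h
  · refine Or.inr ⟨p, κ, h, Or.inl ⟨h1, h2, fun a' ha' ho => ?_⟩⟩
    have := (h3 (π⁻¹ a') ((key a').1.symm.trans ha') ((key a').2 ho)).perm hD
    rwa [show π (π⁻¹ a') = a' from π.apply_symm_apply a'] at this
  · refine Or.inr ⟨p, κ, h, Or.inr ⟨h1, h2, fun a' ha' ho => ?_⟩⟩
    have := (h3 (π⁻¹ a') ((key a').1.symm.trans ha') ((key a').2 ho)).perm hD
    rwa [show π (π⁻¹ a') = a' from π.apply_symm_apply a'] at this

open Classical in
/-- The data vectors of a block with its pending letter and its exit letter. -/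
noncomputable def blockVectors (A : FMA 1 Atoms H State) (S : Finset Atoms)
    (l : BlockLetter H State S) : Set (DataVector H Atoms) :=
  if trace S l.2.1 = l.1.1.2.1 ∧ A.ExitAllowed S l then
    {optLetter l.1.1.2.2 l.2.1} + A.block l.2.1 l.1.1.1 l.1.2.1 + {optLetter l.1.2.2.2 l.2.2}
  else ∅

theorem mem_blockVectors {A : FMA 1 Atoms H State} {S : Finset Atoms} {l : BlockLetter H State S}
    {x : DataVector H Atoms} : x ∈ A.blockVectors S l ↔
      trace S l.2.1 = l.1.1.2.1 ∧ A.ExitAllowed S l ∧ ∃ y ∈ A.block l.2.1 l.1.1.1 l.1.2.1,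
        x = optLetter l.1.1.2.2 l.2.1 + y + optLetter l.1.2.2.2 l.2.2 := by
  unfold blockVectors
  split_ifs with h
  · simp only [h.1, h.2, true_and, Set.singleton_add, Set.add_singleton, Set.mem_image]
    constructor
    · rintro ⟨_, ⟨y, hy, rfl⟩, rfl⟩
      exact ⟨y, hy, rfl⟩
    · rintro ⟨y, hy, rfl⟩
      exact ⟨_, ⟨y, hy, rfl⟩, rfl⟩
  · simp only [Set.mem_empty_iff_false, false_iff]
    exact fun h' => h ⟨h'.1, h'.2.1⟩

theorem hasRationalExpr_blockVectors [Infinite Atoms] [Finite H] [Finite State]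
    (A : FMA 1 Atoms H State) (S : Finset Atoms) (l : BlockLetter H State S) :
    HasRationalExpr 1 (A.blockVectors S l) := by
  unfold blockVectors
  split_ifs
  · exact ((hasRationalExpr_optLetter 1 _ _).add (A.hasRationalExpr_block _ _ _)).add
      (hasRationalExpr_optLetter 1 _ _)
  · exact .empty 1

theorem rename_image_blockVectors_subset {A : FMA 1 Atoms H State} {S : Finset Atoms}
    (hDS : A.D ⊆ S) {π : Equiv.Perm Atoms} (hπ : ∀ a ∈ S, π a = a) (l : BlockLetter H State S) :
    rename π '' A.blockVectors S l ⊆ A.blockVectors S (renameLetter π l) := by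
  rintro _ ⟨x, hx, rfl⟩
  obtain ⟨h1, h2, y, hy, rfl⟩ := mem_blockVectors.1 hx
  refine mem_blockVectors.2 ⟨(trace_perm hπ _).trans h1, h2.perm hDS hπ, rename π y,
    rename_image_block_subset (fun d hd => hπ d (hDS hd)) _ _ _ ⟨y, hy, rfl⟩, ?_⟩
  rw [rename_add, rename_add, rename_optLetter, rename_optLetter]
  rfl

/-- The last block of a run: it ends the run in an accepting state. -/
def IsFinal (A : FMA 1 Atoms H State) {S : Finset Atoms} (l : BlockLetter H State S) : Prop :=
  l.1.2.2.1 = none ∧ l.1.2.1 ∈ A.accept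

/-- Linked words of blocks come from runs. -/
theorem exists_acceptsFrom_of_linked {A : FMA 1 Atoms H State} {S : Finset Atoms}
    (s : List (BlockLetter H State S)) (l : BlockLetter H State S)
    (hs : (portSystem H State S).Linked (l :: s)) (hlast : ∃ l' ∈ (l :: s).getLast?, A.IsFinal l')
    {x : DataVector H Atoms} (hx : x ∈ ((l :: s).map (A.blockVectors S)).sum) :
    ∃ word, A.AcceptsFrom l.1.1.1 l.2.1 word ∧ x = optLetter l.1.1.2.2 l.2.1 + parikh word := by
  induction s generalizing l x with
  | nil =>
    obtain ⟨_, hl, hfin⟩ := hlast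
    cases hl
    have hfin : A.IsFinal l := hfin
    simp only [List.map_cons, List.map_nil, List.sum_cons, List.sum_nil, add_zero] at hx
    obtain ⟨h1, h2, _, ⟨word, hw, rfl⟩, rfl⟩ := mem_blockVectors.1 hx
    have he : l.1.2.2.2 = none := by
      rcases h2 with h2 | ⟨p, κ, h, ⟨h2, -⟩ | ⟨h2, -⟩⟩
      · exact h2.2
      · rw [hfin.1] at h2; cases h2
      · rw [hfin.1] at h2; cases h2
    refine ⟨word, ?_, by simp [he, optLetter]⟩
    have := hw.acceptsFrom (word' := []) ⟨_, .nil _, hfin.2⟩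
    rwa [List.append_nil] at this
  | cons d s ih =>
    rw [List.map_cons, List.sum_cons] at hx
    obtain ⟨x, hx, z, hz, rfl⟩ := hx
    obtain ⟨⟨hlink1, hlink2⟩, hs'⟩ := List.isChain_cons_cons.1 hs
    obtain ⟨word', hw', rfl⟩ := ih d hs' hlast hz
    have hd : trace S d.2.1 = d.1.1.2.1 := by
      rw [List.map_cons, List.sum_cons] at hz
      obtain ⟨y, hy, -⟩ := hz
      exact (mem_blockVectors.1 hy).1
    obtain ⟨h1, h2, _, ⟨word, hw, rfl⟩, rfl⟩ := mem_blockVectors.1 hx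
    have hlink1 : l.1.2.2.1 = some d.1.1 := hlink1
    have hlink2 : d.2.1 ∉ (portSystem H State S).out l := hlink2
    rcases h2 with ⟨h2, -⟩ | ⟨p, κ, h, ⟨h2, h3, h4⟩ | ⟨h2, h3, h4⟩⟩
    · rw [hlink1] at h2; cases h2
    · have e := Option.some.inj (hlink1.symm.trans h2)
      rw [e] at hd hw'
      refine ⟨word ++ (h, l.2.2) :: word', hw.acceptsFrom ((h4 _ hd hlink2).acceptsFrom hw'), ?_⟩
      rw [parikh_append, parikh_cons, e, h3]
      simp only [optLetter, Option.elim_some, Option.elim_none, zero_add, add_assoc]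
    · have e := Option.some.inj (hlink1.symm.trans h2)
      rw [e] at hd hw'
      refine ⟨word ++ (h, d.2.1) :: word', hw.acceptsFrom ((h4 _ hd hlink2).acceptsFrom hw'), ?_⟩
      rw [parikh_append, parikh_cons, e, h3]
      simp only [optLetter, Option.elim_some, Option.elim_none, add_zero, add_assoc]

/-- Runs can be cut into linked words of blocks, whatever letter is left pending for the first
block. -/
theorem exists_linked_of_run {A : FMA 1 Atoms H State} {S : Finset Atoms} (hDS : A.D ⊆ S)
    {c c' : State × (Fin 1 ↪ Atoms)} {word : List (H × Atoms)} (hrun : A.Run c word c')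
    (hacc : c'.1 ∈ A.accept) (e : Option H) :
    ∃ (s : List (BlockLetter H State S)) (l : BlockLetter H State S),
      l.1.1 = (c.1, trace S (c.2 0), e) ∧ l.2.1 = c.2 0 ∧
      (portSystem H State S).Linked (l :: s) ∧ (∃ l' ∈ (l :: s).getLast?, A.IsFinal l') ∧
      optLetter e (c.2 0) + parikh word ∈ ((l :: s).map (A.blockVectors S)).sum := by
  induction hrun generalizing e with
  | nil c =>
    refine ⟨[], (((c.1, trace S (c.2 0), e), c.1, none, none), c.2 0, c.2 0), rfl, rfl,
      List.isChain_singleton _, ⟨_, rfl, rfl, hacc⟩, ?_⟩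
    simp only [List.map_cons, List.map_nil, List.sum_cons, List.sum_nil, add_zero]
    exact mem_blockVectors.2 ⟨rfl, Or.inl ⟨rfl, rfl⟩, 0, ⟨[], .nil _, rfl⟩, by
      simp [parikh, optLetter]⟩
  | @cons c₁ c₂ c₃ σ word hstep _ ih =>
    have hs : A.StepAt c₁.1 (c₁.2 0) σ.1 σ.2 c₂.1 (c₂.2 0) := by
      unfold StepAt
      rw [reg_apply_zero, reg_apply_zero]
      exact hstep
    generalize ha : c₁.2 0 = a at *
    generalize ha' : c₂.2 0 = a' at *
    by_cases haa : a = a'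
    · -- The transition is added to the first block.
      subst haa
      obtain ⟨s, l, h1, h2, h3, h4, h5⟩ := ih hacc e
      obtain ⟨⟨p, q, t, e'⟩, b, b'⟩ := l
      simp only at h1 h2
      subst h1 h2
      refine ⟨s, (((c₁.1, trace S b, e), q, t, e'), b, b'), rfl, rfl, ?_, ?_, ?_⟩
      · cases s with
        | nil => exact List.isChain_singleton _
        | cons d s =>
          obtain ⟨h, h'⟩ := List.isChain_cons_cons.1 h3
          exact List.isChain_cons_cons.2 ⟨h, h'⟩
      · cases s with
        | nil =>
          obtain ⟨_, hl, hfin⟩ := h4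
          cases hl
          exact ⟨_, rfl, hfin⟩
        | cons d s =>
          rw [List.getLast?_cons_cons] at h4 ⊢
          exact h4
      · rw [List.map_cons, List.sum_cons] at h5 ⊢
        obtain ⟨x, hx, z, hz, hxz⟩ := h5
        obtain ⟨g1, g2, _, ⟨word', hw, rfl⟩, rfl⟩ := mem_blockVectors.1 hx
        refine ⟨optLetter e b + parikh (σ :: word') + optLetter e' b', mem_blockVectors.2
          ⟨rfl, g2, _, ⟨_, .cons hs hw, rfl⟩, rfl⟩, z, hz, ?_⟩
        simp only at hxz ⊢
        have hxz' : parikh word' + optLetter e' b' + z = parikh word := by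
          rw [add_assoc, add_assoc] at hxz
          rw [add_assoc]
          exact add_left_cancel hxz
        rw [parikh_cons, parikh_cons, ← hxz']
        abel
    -- The transition is the exit of a new block; its letter is left pending if it is stored.
    have key : ∀ (e₁ e₂ : Option H) (b : Atoms), optLetter e₁ b + optLetter e₂ a' =
          Finsupp.single σ 1 →
        (∀ t, A.ExitAllowed S ((t, c₁.1, some (c₂.1, trace S a', e₂), e₁), a, b)) →
        (a' = b → a' ∈ S) →
        ∃ (s : List (BlockLetter H State S)) (l : BlockLetter H State S),
          l.1.1 = (c₁.1, trace S a, e) ∧ l.2.1 = a ∧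
          (portSystem H State S).Linked (l :: s) ∧ (∃ l' ∈ (l :: s).getLast?, A.IsFinal l') ∧
          optLetter e a + parikh (σ :: word) ∈ ((l :: s).map (A.blockVectors S)).sum := by
      intro e₁ e₂ b hσ hexit hb
      obtain ⟨s, l, h1, h2, h3, h4, h5⟩ := ih hacc e₂
      refine ⟨l :: s, (((c₁.1, trace S a, e), c₁.1, some (c₂.1, trace S a', e₂), e₁), a, b),
        rfl, rfl, List.isChain_cons_cons.2 ⟨⟨congrArg some h1.symm, ?_⟩, h3⟩, ?_, ?_⟩
      · show l.2.1 ∉ _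
        rw [h2, mem_portSystem_out]
        rintro ⟨h | h, h'⟩
        · exact haa h.symm
        · exact h' (hb h)
      · rw [List.getLast?_cons_cons]
        exact h4
      · rw [List.map_cons, List.sum_cons]
        refine ⟨_, mem_blockVectors.2 ⟨rfl, hexit _, 0, ⟨[], .nil _, rfl⟩, rfl⟩, _, h5, ?_⟩
        simp only
        rw [parikh_cons, ← hσ]
        abel
    have hσ : σ = (σ.1, σ.2) := rfl
    by_cases hba : σ.2 = a'
    · refine key none (some σ.1) a (by simp [optLetter, ← hba]) (fun t => ?_)
        fun h => absurd h.symm haa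
      refine Or.inr ⟨c₂.1, trace S a', σ.1, Or.inr ⟨rfl, rfl, fun a'' ht ho => ?_⟩⟩
      rw [hba] at hs
      rcases trace_eq_trace ht with rfl | ⟨h'', h'⟩
      · exact hs
      · rw [mem_portSystem_out] at ho
        refine hs.change_input (fun h => h' (hDS h)) (fun h => h'' (hDS h)) haa fun h => ho ?_
        exact ⟨Or.inl h.symm, h''⟩
    · refine key (some σ.1) none σ.2 (by simp [optLetter]) (fun t => ?_)
        fun h => absurd h.symm hba
      refine Or.inr ⟨c₂.1, trace S a', σ.1, Or.inl ⟨rfl, rfl, fun a'' ht ho => ?_⟩⟩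
      rcases trace_eq_trace ht with rfl | ⟨h'', h'⟩
      · exact hs
      · rw [mem_portSystem_out] at ho
        exact hs.change_next (fun h => h' (hDS h)) (fun h => h'' (hDS h)) haa
          (fun h => ho ⟨Or.inl h.symm, h''⟩) hba (fun h => ho ⟨Or.inr h.symm, h''⟩)

theorem hasRationalExpr_parikhImage [Infinite Atoms] [Finite H] [Finite State]
    (A : FMA 1 Atoms H State) : HasRationalExpr 2 (parikhImage A.language) := by
  classical
  let S : Finset Atoms := insert (A.initReg 0) A.D
  have hDS : A.D ⊆ S := Finset.subset_insert _ _
  have hinit : A.initReg 0 ∈ S := Finset.mem_insert_self _ _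
  have hfix : ∀ π ∈ fixingSubgroup (Equiv.Perm Atoms) (S : Set Atoms), ∀ a ∈ S, π a = a :=
    fun π hπ a ha => (mem_fixingSubgroup_iff _).1 hπ a ha
  have key := HasRationalExpr.linkedWords (portSystem H State S) S.finite_toSet
    (fun π hπ => portSystem_isInvariant (hfix π hπ)) (A.hasRationalExpr_blockVectors S)
    (fun π hπ => rename_image_blockVectors_subset hDS (hfix π hπ))
    (first := fun l => l.1.1 = (A.init, trace S (A.initReg 0), none) ∧ l.2.1 = A.initReg 0)
    (last := fun l => A.IsFinal l)
    (fun π hπ l hl => ⟨hl.1, by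
      simp only [renameLetter]
      rw [hl.2, hfix π hπ _ hinit]⟩)
    (fun _ _ _ hl => hl)
  convert key using 1
  ext x
  constructor
  · rintro ⟨word, ⟨c, hrun, hacc⟩, rfl⟩
    obtain ⟨s, l, h1, h2, h3, h4, h5⟩ := exists_linked_of_run (S := S) hDS hrun hacc none
    refine ⟨l :: s, h3, ⟨l, rfl, h1, h2⟩, h4, ?_⟩
    simpa [optLetter] using h5
  · rintro ⟨s, h1, ⟨l, hl, h2, h3⟩, h4, hx⟩
    cases s with
    | nil => simp at hl
    | cons d s =>
      cases hl
      obtain ⟨word, ⟨c, hrun, hacc⟩, rfl⟩ := exists_acceptsFrom_of_linked s l h1 h4 hx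
      rw [h2, h3, reg_apply_zero] at hrun
      refine ⟨word, ⟨c, hrun, hacc⟩, ?_⟩
      simp [h2, optLetter]

end FMA

/-! ### Sets of star-height at most one -/

/-- Over an orbit-finite set, finitely many elements represent all others up to permutations that
fix a given finite set of atoms. -/
theorem IsOrbitFinite.exists_finite_representatives {Atoms : Type u} [Infinite Atoms] {ι : Type*}
    [MulAction (Equiv.Perm Atoms) ι] {X : Set ι} (hX : IsOrbitFinite Atoms X) {S : Set Atoms}
    (hS : S.Finite) :
    ∃ T : Set ι, T.Finite ∧
      ∀ x ∈ X, ∃ π ∈ fixingSubgroup (Equiv.Perm Atoms) S, π • x ∈ T := by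
  classical
  obtain ⟨hsup, S₀, -, T₀, hT₀, rfl⟩ := hX
  have key : ∀ t ∈ T₀, ∃ T : Set ι, T.Finite ∧
      ∀ σ : Equiv.Perm Atoms, ∃ π ∈ fixingSubgroup (Equiv.Perm Atoms) S, π • σ • t ∈ T := by
    intro t ht
    obtain ⟨A, hA, hAt⟩ := hsup t (Set.mem_iUnion₂.2 ⟨t, ht, MulAction.mem_orbit_self t⟩)
    obtain ⟨W, hSW, hW⟩ := Infinite.exists_superset_card_eq hS.toFinset
      (hS.toFinset.card + hA.toFinset.card) (Nat.le_add_right _ _)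
    -- An element `g • t` depends only on the restriction of `g` to the support of `t`.
    let r : (hA.toFinset → W) → ι := fun f =>
      if h : ∃ g : Equiv.Perm Atoms, ∀ a : hA.toFinset, g a = f a then h.choose • t else t
    refine ⟨Set.range r, Set.finite_range r, fun σ => ?_⟩
    obtain ⟨ρ, h1, h2⟩ := exists_perm_fixing_mapsTo hS.toFinset (hA.toFinset.image σ) W hSW (by
      rw [Finset.card_sdiff_of_subset hSW, hW, Nat.add_sub_cancel_left]
      exact (Finset.card_le_card Finset.sdiff_subset).trans Finset.card_image_le)
    refine ⟨ρ, (mem_fixingSubgroup_iff _).2 fun a ha => h1 a (hS.mem_toFinset.2 ha),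
      fun a => ⟨(ρ * σ) a, h2 _ (Finset.mem_image_of_mem _ a.2)⟩, ?_⟩
    have hex : ∃ g : Equiv.Perm Atoms, ∀ a : hA.toFinset, g a = (ρ * σ) a := ⟨ρ * σ, fun _ => rfl⟩
    have hr : r (fun a => ⟨(ρ * σ) a, h2 _ (Finset.mem_image_of_mem _ a.2)⟩) = hex.choose • t :=
      dif_pos hex
    rw [hr, smul_smul, ← inv_smul_eq_iff, smul_smul]
    refine hAt _ fun a ha => ?_
    rw [Equiv.Perm.smul_def, Equiv.Perm.mul_apply, hex.choose_spec ⟨a, hA.mem_toFinset.2 ha⟩]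
    exact (ρ * σ).symm_apply_apply a
  choose! T hT hT' using key
  refine ⟨⋃ t ∈ T₀, T t, hT₀.biUnion hT, fun x hx => ?_⟩
  obtain ⟨t, ht, σ, rfl⟩ := Set.mem_iUnion₂.1 hx
  obtain ⟨π, h1, h2⟩ := hT' t ht σ.1
  exact ⟨π, h1, Set.mem_iUnion₂.2 ⟨t, ht, h2⟩⟩

namespace DataVector

variable {H : Type v} {Atoms : Type u}

/-- Renaming, as a homomorphism. -/
noncomputable def renameHom (π : Equiv.Perm Atoms) : DataVector H Atoms →+ DataVector H Atoms where
  toFun := rename π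
  map_zero' := rename_zero π
  map_add' := rename_add π

theorem degree_rename (π : Equiv.Perm Atoms) (x : DataVector H Atoms) :
    (rename π x).degree = x.degree :=
  Finsupp.degree_mapDomain _ _

/-- A bound that does not change under renaming holds uniformly on an orbit-finite set. -/
theorem exists_bound_of_isOrbitFinite [Infinite Atoms] {ι : Type*} [MulAction (Equiv.Perm Atoms) ι]
    {X : Set ι} (hX : IsOrbitFinite Atoms X) {f : ι → Set (DataVector H Atoms)}
    (hf : FinitelySupportedOn X f) {p : ℕ → Set (DataVector H Atoms) → Prop}
    (hmono : ∀ K K' R, K ≤ K' → p K R → p K' R)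
    (hp : ∀ K R (π : Equiv.Perm Atoms), p K R → p K (rename π '' R))
    (h : ∀ x ∈ X, ∃ K, p K (f x)) : ∃ K, ∀ x ∈ X, p K (f x) := by
  obtain ⟨S, hS, hf⟩ := hf
  obtain ⟨T, hT, hT'⟩ := hX.exists_finite_representatives hS
  choose! K hK using h
  obtain ⟨B, hB⟩ := (hT.image K).bddAbove
  refine ⟨B, fun x hx => ?_⟩
  obtain ⟨π, hπ, hxT⟩ := hT' x hx
  obtain ⟨h1, h2⟩ := hf π hπ x hx
  have h3 := hp _ _ π⁻¹ (hmono _ _ _ (hB ⟨_, hxT, rfl⟩) (hK _ h1))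
  rw [h2, Set.image_image] at h3
  simpa [← rename_mul, rename_one] using h3

theorem kleeneStar_eq_closure (R : Set (DataVector H Atoms)) :
    kleeneStar R = AddSubmonoid.closure R := by
  ext x
  constructor
  · rintro ⟨l, hl, rfl⟩
    exact AddSubmonoid.list_sum_mem _ fun y hy => AddSubmonoid.subset_closure (hl y hy)
  · exact AddSubmonoid.exists_list_of_mem_closure

/-- Each element of `R` lies in a subset of `R` of the form `b + P*`, where `b` and the elements of
`P` have degree at most `K`. -/
def IsBoundedlyLinear (K : ℕ) (R : Set (DataVector H Atoms)) : Prop :=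
  ∀ x ∈ R, ∃ (b : DataVector H Atoms) (P : Set (DataVector H Atoms)), b.degree ≤ K ∧
    (∀ p ∈ P, p.degree ≤ K) ∧ (∃ y ∈ AddSubmonoid.closure P, b + y = x) ∧
    ∀ y ∈ AddSubmonoid.closure P, b + y ∈ R

theorem IsBoundedlyLinear.mono {K K' : ℕ} (hK : K ≤ K') {R : Set (DataVector H Atoms)}
    (h : IsBoundedlyLinear K R) : IsBoundedlyLinear K' R := by
  intro x hx
  obtain ⟨b, P, h1, h2, h3⟩ := h x hx
  exact ⟨b, P, h1.trans hK, fun p hp => (h2 p hp).trans hK, h3⟩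

theorem IsBoundedlyLinear.rename_image {K : ℕ} {R : Set (DataVector H Atoms)}
    (h : IsBoundedlyLinear K R) (π : Equiv.Perm Atoms) :
    IsBoundedlyLinear K (rename π '' R) := by
  rintro _ ⟨x, hx, rfl⟩
  obtain ⟨b, P, h1, h2, ⟨y, hy, rfl⟩, h4⟩ := h x hx
  have hmap : AddSubmonoid.closure (rename π '' P) =
      (AddSubmonoid.closure P).map (renameHom π) := (AddMonoidHom.map_mclosure (renameHom π) P).symm
  refine ⟨rename π b, rename π '' P, by rwa [degree_rename], ?_, ⟨rename π y, ?_, ?_⟩, ?_⟩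
  · rintro _ ⟨p, hp, rfl⟩
    rw [degree_rename]
    exact h2 p hp
  · rw [hmap]
    exact ⟨y, hy, rfl⟩
  · rw [rename_add]
  · rw [hmap]
    rintro _ ⟨z, hz, rfl⟩
    exact ⟨b + z, h4 z hz, rename_add π b z⟩

theorem isBoundedlyLinear_singleton (x : DataVector H Atoms) : IsBoundedlyLinear x.degree {x} := by
  intro y hy
  have hy : y = x := hy
  subst hy
  refine ⟨y, ∅, le_rfl, by simp, ⟨0, zero_mem _, add_zero y⟩, fun z hz => ?_⟩
  rw [AddSubmonoid.closure_empty, AddSubmonoid.mem_bot] at hz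
  simp [hz]

theorem IsBoundedlyLinear.add {K K' : ℕ} {R R' : Set (DataVector H Atoms)}
    (h : IsBoundedlyLinear K R) (h' : IsBoundedlyLinear K' R') :
    IsBoundedlyLinear (K + K') (R + R') := by
  rintro _ ⟨x, hx, x', hx', rfl⟩
  obtain ⟨b, P, h1, h2, ⟨y, hy, rfl⟩, h4⟩ := h x hx
  obtain ⟨b', P', h1', h2', ⟨y', hy', rfl⟩, h4'⟩ := h' x' hx'
  refine ⟨b + b', P ∪ P', ?_, ?_, ⟨y + y', ?_, add_add_add_comm b b' y y'⟩, ?_⟩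
  · rw [map_add]
    exact add_le_add h1 h1'
  · rintro p (hp | hp)
    · exact (h2 p hp).trans (Nat.le_add_right _ _)
    · exact (h2' p hp).trans (Nat.le_add_left _ _)
  · rw [AddSubmonoid.closure_union]
    exact AddSubmonoid.add_mem_sup hy hy'
  · intro z hz
    rw [AddSubmonoid.closure_union] at hz
    obtain ⟨z, hz₁, z', hz₂, rfl⟩ := AddSubmonoid.mem_sup.1 hz
    rw [add_add_add_comm]
    exact Set.add_mem_add (h4 z hz₁) (h4' z' hz₂)

theorem HasRationalExpr.exists_degree_le [Infinite Atoms] {n : ℕ} {R : Set (DataVector H Atoms)}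
    (h : HasRationalExpr n R) (hn : n = 0) : ∃ K, ∀ x ∈ R, x.degree ≤ K := by
  induction h with
  | zero n => exact ⟨0, by simp⟩
  | letter n σ => exact ⟨1, by simp [Finsupp.degree_single]⟩
  | add _ _ ih ih' =>
    obtain ⟨K, hK⟩ := ih hn
    obtain ⟨K', hK'⟩ := ih' hn
    refine ⟨K + K', ?_⟩
    rintro _ ⟨x, hx, y, hy, rfl⟩
    rw [map_add]
    exact add_le_add (hK x hx) (hK' y hy)
  | kleeneStar _ _ => exact absurd hn (Nat.succ_ne_zero _)
  | orbitFiniteUnion X f hX hf _ ih =>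
    obtain ⟨K, hK⟩ := exists_bound_of_isOrbitFinite hX hf
      (p := fun K R => ∀ x ∈ R, x.degree ≤ K)
      (fun K K' R hK h x hx => (h x hx).trans hK)
      (fun K R π h => by
        rintro _ ⟨x, hx, rfl⟩
        rw [degree_rename]
        exact h x hx)
      (fun x hx => ih x hx hn)
    refine ⟨K, fun y hy => ?_⟩
    obtain ⟨x, hx, hy⟩ := Set.mem_iUnion₂.1 hy
    exact hK x hx y hy

/-- An expression of star-height one is, up to orbit-finite unions, a sum of bounded vectors and
stars of bounded sets. -/
theorem HasRationalExpr.exists_isBoundedlyLinear [Infinite Atoms] {n : ℕ}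
    {R : Set (DataVector H Atoms)} (h : HasRationalExpr n R) (hn : n ≤ 1) :
    ∃ K, IsBoundedlyLinear K R := by
  induction h with
  | zero n => exact ⟨_, isBoundedlyLinear_singleton 0⟩
  | letter n σ => exact ⟨_, isBoundedlyLinear_singleton _⟩
  | add _ _ ih ih' =>
    obtain ⟨K, hK⟩ := ih hn
    obtain ⟨K', hK'⟩ := ih' hn
    exact ⟨K + K', hK.add hK'⟩
  | @kleeneStar n R hR _ =>
    obtain ⟨K, hK⟩ := hR.exists_degree_le (by omega)
    refine ⟨K, ?_⟩
    rw [kleeneStar_eq_closure]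
    intro x hx
    exact ⟨0, R, by simp, hK, ⟨x, hx, zero_add x⟩, fun y hy => by rwa [zero_add]⟩
  | orbitFiniteUnion X f hX hf _ ih =>
    obtain ⟨K, hK⟩ := exists_bound_of_isOrbitFinite hX hf (p := IsBoundedlyLinear)
      (fun K K' R hK h => h.mono hK) (fun K R π h => h.rename_image π) (fun x hx => ih x hx hn)
    refine ⟨K, fun y hy => ?_⟩
    obtain ⟨x, hx, hy⟩ := Set.mem_iUnion₂.1 hy
    obtain ⟨b, P, h1, h2, h3, h4⟩ := hK x hx y hy
    exact ⟨b, P, h1, h2, h3, fun z hz => Set.mem_iUnion₂.2 ⟨x, hx, h4 z hz⟩⟩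

/-- Suppose that in the elements of `R` the label `h'` occurs with an atom only if `h` does.  Then
a single occurrence of `h` cannot account for arbitrarily many of `h'` by bounded periods, if
there are more atoms than a bounded base can contain. -/
theorem not_isBoundedlyLinear [Infinite Atoms] {R : Set (DataVector H Atoms)} {h h' : H}
    (hne : h ≠ h') (hR : ∀ x ∈ R, ∀ a, x (h, a) = 0 → x (h', a) = 0)
    (hmem : ∀ (F : Finset Atoms) (m : ℕ),
      ∑ a ∈ F, (Finsupp.single (h, a) 1 + Finsupp.single (h', a) m) ∈ R) (K : ℕ) :
    ¬ IsBoundedlyLinear K R := by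
  classical
  intro hlin
  obtain ⟨F, hF⟩ := Infinite.exists_subset_card_eq Atoms (K + 1)
  obtain ⟨b, P, h1, h2, ⟨y, hy, hby⟩, h4⟩ := hlin _ (hmem F (K + 1))
  obtain ⟨a, ha, hba⟩ : ∃ a ∈ F, b (h, a) = 0 := by
    by_contra! hcon
    have hle : F.card ≤ b.support.card :=
      Finset.card_le_card_of_injOn (fun a => (h, a))
        (fun a ha => Finsupp.mem_support_iff.2 (hcon a ha))
        (fun _ _ _ _ e => (Prod.mk.inj e).2)
    have hdeg : b.support.card ≤ b.degree := by
      rw [Finsupp.degree_apply, Finset.card_eq_sum_ones]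
      exact Finset.sum_le_sum fun i hi => Nat.one_le_iff_ne_zero.2 (Finsupp.mem_support_iff.1 hi)
    omega
  have hb' : b (h', a) = 0 := by
    have := hR _ (h4 0 (zero_mem _)) a
    rw [add_zero] at this
    exact this hba
  have hsum : ∀ k : H, (b + y) (k, a) =
      (if k = h then 1 else 0) + if k = h' then K + 1 else 0 := by
    intro k
    rw [hby, Finsupp.finsetSum_apply, Finset.sum_eq_single a]
    · simp only [Finsupp.add_apply, Finsupp.single_apply, Prod.mk.injEq, and_true, eq_comm]
    · intro c _ hc
      simp [hc]
    · exact fun hn => absurd ha hn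
  have hy1 := hsum h
  have hy2 := hsum h'
  rw [Finsupp.add_apply, hba, if_pos rfl, if_neg hne] at hy1
  rw [Finsupp.add_apply, hb', if_pos rfl, if_neg hne.symm] at hy2
  have hle : y (h', a) ≤ K * y (h, a) := by
    refine AddSubmonoid.closure_induction (motive := fun y _ => y (h', a) ≤ K * y (h, a))
      (fun p hp => ?_) (by simp) (fun x z _ _ hx hz => ?_) hy
    · by_cases hp0 : p (h, a) = 0
      · have := hR _ (h4 p (AddSubmonoid.subset_closure hp)) a
        simp only [Finsupp.add_apply, hba, hb', hp0, zero_add] at this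
        simp [this trivial]
      · calc p (h', a) ≤ p.degree := Finsupp.le_degree _ _
          _ ≤ K := h2 p hp
          _ ≤ K * p (h, a) := Nat.le_mul_of_pos_right _ (Nat.pos_of_ne_zero hp0)
    · rw [Finsupp.add_apply, Finsupp.add_apply, mul_add]
      exact add_le_add hx hz
  have e1 : y (h, a) = 1 := by omega
  rw [e1] at hle
  omega

end DataVector

/-! ### A language whose Parikh image has star-height two -/

namespace FMA

open DataVector

variable {Atoms : Type u}

/-- The words that consist of blocks `(false, a) (true, a) ⋯ (true, a)`.  The letter `(false, a)`
stores its atom, and a letter `(true, a)` must repeat the stored one; the state is `true` once an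
atom has been stored. -/
def blockLanguageAutomaton (a₀ : Atoms) : FMA 1 Atoms Bool Bool where
  init := false
  accept := Set.univ
  D := ∅
  initReg := reg a₀
  rules := {(false, false, .eq .input (.next 0), true), (true, false, .eq .input (.next 0), true),
    (true, true, .and (.eq .input (.reg 0)) (.eq .input (.next 0)), true)}
  rules_finite := by simp

theorem parikh_eq_zero_of_run {a₀ : Atoms} {c c' : Bool × (Fin 1 ↪ Atoms)}
    {word : List (Bool × Atoms)} (hrun : (blockLanguageAutomaton a₀).Run c word c') {a : Atoms}
    (ha : parikh word (false, a) = 0) (hc : c.1 = true → c.2 0 ≠ a) :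
    parikh word (true, a) = 0 := by
  classical
  induction hrun with
  | nil c => simp [parikh]
  | @cons c₁ c₂ c₃ σ word hstep _ ih =>
    obtain ⟨h, b⟩ := σ
    rw [parikh_cons, Finsupp.add_apply] at ha ⊢
    obtain ⟨ha1, ha2⟩ := Nat.add_eq_zero_iff.1 ha
    obtain ⟨φ, hφ, hholds⟩ := hstep
    have hstored : h = false → b = c₂.2 0 → Finsupp.single (h, b) 1 (true, a) +
        parikh word (true, a) = 0 := by
      rintro rfl hb
      have hba : b ≠ a := by rintro rfl; simp at ha1
      rw [ih ha2 fun _ => hb ▸ hba]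
      simp
    rcases hφ with hφ | hφ | hφ
    · have e : φ = .eq .input (.next 0) := congrArg (fun p => p.2.2.1) hφ
      subst e
      exact hstored (congrArg (fun p => p.2.1) hφ) hholds
    · have e : φ = .eq .input (.next 0) := congrArg (fun p => p.2.2.1) hφ
      subst e
      exact hstored (congrArg (fun p => p.2.1) hφ) hholds
    · have e : φ = .and (.eq .input (.reg 0)) (.eq .input (.next 0)) :=
        congrArg (fun p => p.2.2.1) hφ
      subst e
      have h1 : c₁.1 = true := congrArg (fun p => p.1) hφ
      obtain ⟨hb1, hb2⟩ : b = c₁.2 0 ∧ b = c₂.2 0 := hholds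
      have hba : b ≠ a := hb1 ▸ hc h1
      rw [ih ha2 fun _ => hb2 ▸ hba]
      simp [hba]

theorem exists_acceptsFrom_sum (a₀ : Atoms) (F : Finset Atoms) (m : ℕ) :
    ∃ word : List (Bool × Atoms),
      (∀ q a, (blockLanguageAutomaton a₀).AcceptsFrom q a word) ∧
      parikh word = ∑ a ∈ F, (Finsupp.single (false, a) 1 + Finsupp.single (true, a) m) := by
  classical
  induction F using Finset.induction_on with
  | empty => exact ⟨[], fun q a => ⟨_, .nil _, trivial⟩, by simp [parikh]⟩
  | insert a F ha ih =>
    obtain ⟨word, h1, h2⟩ := ih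
    have hrep : ∀ k : ℕ, ∃ word' : List (Bool × Atoms),
        (blockLanguageAutomaton a₀).AcceptsFrom true a word' ∧
        parikh word' = Finsupp.single (true, a) k + parikh word := by
      intro k
      induction k with
      | zero => exact ⟨word, h1 _ _, by simp⟩
      | succ k ihk =>
        obtain ⟨word', h3, h4⟩ := ihk
        refine ⟨(true, a) :: word', StepAt.acceptsFrom (a' := a) (q' := true) ?_ h3, ?_⟩
        · exact ⟨_, Or.inr (Or.inr rfl), rfl, rfl⟩
        · rw [parikh_cons, h4, ← add_assoc, ← Finsupp.single_add, add_comm 1 k]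
    obtain ⟨word', h3, h4⟩ := hrep m
    refine ⟨(false, a) :: word', fun q c => StepAt.acceptsFrom (a' := a) (q' := true) ?_ h3, ?_⟩
    · cases q
      · exact ⟨_, Or.inl rfl, rfl⟩
      · exact ⟨_, Or.inr (Or.inl rfl), rfl⟩
    · rw [parikh_cons, h4, Finset.sum_insert ha, h2, add_assoc]

theorem not_hasRationalExpr_blockLanguage [Infinite Atoms] (a₀ : Atoms) {n : ℕ} (hn : n ≤ 1) :
    ¬ HasRationalExpr n (parikhImage (blockLanguageAutomaton a₀).language) := by
  intro h
  obtain ⟨K, hK⟩ := h.exists_isBoundedlyLinear hn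
  refine not_isBoundedlyLinear Bool.false_ne_true ?_ ?_ K hK
  · rintro _ ⟨word, ⟨c, hrun, -⟩, rfl⟩ a ha
    exact parikh_eq_zero_of_run hrun ha (fun h => by cases h)
  · intro F m
    obtain ⟨word, h1, h2⟩ := exists_acceptsFrom_sum a₀ F m
    exact ⟨word, h1 _ _, h2⟩

end FMA

theorem mainTheorem1 {Atoms : Type u} [Infinite Atoms] :
    (∀ (H : Type v) (State : Type w) [Finite H] [Finite State] (A : FMA 1 Atoms H State),
      DataVector.IsRational (DataVector.parikhImage A.language) ∧
      DataVector.starHeight (DataVector.parikhImage A.language) ≤ 2) ∧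
    (∃ (H : Type) (State : Type) (_ : Finite H) (_ : Finite State) (A : FMA 1 Atoms H State),
      DataVector.IsRational (DataVector.parikhImage A.language) ∧
      DataVector.starHeight (DataVector.parikhImage A.language) = 2) := by
  have upper : ∀ (H : Type v) (State : Type w) [Finite H] [Finite State]
      (A : FMA 1 Atoms H State), DataVector.starHeight (DataVector.parikhImage A.language) ≤ 2 :=
    fun _ _ _ _ A => iInf₂_le 2 A.hasRationalExpr_parikhImage
  refine ⟨fun H State _ _ A => ⟨A.hasRationalExpr_parikhImage.isRational, upper H State A⟩, ?_⟩
  obtain ⟨a₀⟩ : Nonempty Atoms := inferInstance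
  refine ⟨Bool, Bool, inferInstance, inferInstance, FMA.blockLanguageAutomaton a₀,
    (FMA.hasRationalExpr_parikhImage _).isRational,
    le_antisymm (iInf₂_le 2 (FMA.hasRationalExpr_parikhImage _)) (le_iInf₂ fun n hn => ?_)⟩
  by_contra hlt
  refine FMA.not_hasRationalExpr_blockLanguage a₀ (n := n) ?_ hn
  have : n < 2 := by exact_mod_cast not_le.1 hlt
  omega
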